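/- Let $U\ge 1$, $\rho>1$ and $0<p<1/2$, and put $\pi(i,j)=\rho^i/(\rho^i+\rho^j)$. There are $U$ urns, empty at time $0$; at each time $n\ge 1$ one ball, black or white, is added to each urn. Given an environment $x=(x_n^u)_{n\ge1,\,1\le u\le U}\in\{-1,1\}^{\mathbb N\times\{1,\dots,U\}}$, the interacting urn mechanism $\mathrm{IUM}^x$, with law $P^x$, is defined as follows. Let $B^u_n$ and $W^u_n=n-B^u_n$ be the numbers of black and white balls in urn $u$ at time $n$, and $B^*_n=\sum_uB^u_n$, $W^*_n=\sum_uW^u_n$. Let $V_n^u$ be i.i.d. uniform on $[0,1]$. The ball added to urn $u$ at time $n$ is black if and only if $V_n^u<\pi(B^*_{n-1},W^*_{n-1})$ when $x_n^u=1$ (draw from all urns combined), and if and only if $V_n^u<\pi(B^u_{n-1},W^u_{n-1})$ when $x_n^u=-1$ (draw from urn $u$ alone). Write $c_n^u$ for the colour of the ball added to urn $u$ at time $n$. A realization is called $x$-suitable if there are a colour $d$ and a time $n_0$ such that each urn $u$ is either conformist ($c_n^u=d$ for all $n\ge n_0$) or nonconformist (for all $n\ge n_0$: $c_n^u=d$ if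 $x_n^u=1$, and $c_n^u\ne d$ if $x_n^u=-1$). Let $N_{nc}$ be the number of nonconformist urns; the realization satisfies the Conformism Equation if $(1-p)N_{nc}<U/2$ for every choice of $d$ and $n_0$ as above. Then, for almost every environment $x$ with i.i.d. entries, $\mathbb P[x_n^u=1]=p=1-\mathbb P[x_n^u=-1]$, $$P^x[\text{the realization is $x$-suitable and satisfies the Conformism Equation}]=1.$$ -/

import Mathlib

open MeasureTheory ProbabilityTheory
open scoped unitInterval

noncomputable section

namespace InteractingUrns

/-- The two colours of balls. -/
inductive Colour
  | black
  | white

/-- An environment: the entry `1` at `(n, u)` means that the `(n + 1)`-st ball of urn `u` is drawn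
out of all the urns combined, the entry `-1` that it is drawn out of urn `u` alone. -/
abbrev Environment (U : ℕ) : Type := ℕ × Fin U → ℤˣ

/-- `r n u` is the number of black balls in urn `u` at time `n`; all urns start empty and one ball
is added to each urn at each step. -/
def IsUrnPath {U : ℕ} (r : ℕ → Fin U → ℕ) : Prop :=
  (∀ u, r 0 u = 0) ∧ ∀ n u, r (n + 1) u = r n u ∨ r (n + 1) u = r n u + 1

/-- The set of urn paths, with the σ-algebra generated by the coordinates. -/
abbrev UrnPath (U : ℕ) : Type := {r : ℕ → Fin U → ℕ // IsUrnPath r}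

/-- The probability `w i / (w i + w j)` of drawing black out of `i` black and `j` white balls,
for the reinforcement weights `w`. -/
def drawProb (w : ℕ → ℝ) (i j : ℕ) : ℝ := w i / (w i + w j)

/-- The probability that the ball added to urn `u` is black, when the draw is of type `e` (`1` for
all the urns combined, `-1` for urn `u` alone), each urn contains `n` balls and `b v` of the balls
in urn `v` are black. -/
def blackProb {U : ℕ} (w : ℕ → ℝ) (e : ℤˣ) (n : ℕ) (b : Fin U → ℕ) (u : Fin U) : ℝ :=
  if e = 1 then drawProb w (∑ v, b v) (∑ v, (n - b v)) else drawProb w (b u) (n - b u)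

open Classical in
/-- The process of numbers of black balls in the environment `x`, driven by the numbers
`V (n, u) ∈ [0, 1]`: the ball added to urn `u` at step `n + 1` is black if and only if `V (n, u)` is
smaller than the probability of black. -/
def process {U : ℕ} (w : ℕ → ℝ) (x : Environment U) (V : ℕ × Fin U → I) : ℕ → Fin U → ℕ
  | 0 => fun _ => 0
  | n + 1 => fun u =>
      process w x V n u +
        if (V (n, u) : ℝ) < blackProb w (x (n, u)) n (process w x V n) u then 1 else 0

theorem isUrnPath_process {U : ℕ} (w : ℕ → ℝ) (x : Environment U) (V : ℕ × Fin U → I) :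
    IsUrnPath (process w x V) := by
  refine ⟨fun u => rfl, fun n u => ?_⟩
  simp only [process]
  split_ifs <;> simp

/-- The interacting urn mechanism in the environment `x` with weights `w`: the law, on the set of
urn paths, of the process driven by independent uniform random variables on `[0, 1]`. -/
def IUM {U : ℕ} (w : ℕ → ℝ) (x : Environment U) : Measure (UrnPath U) :=
  (Measure.infinitePi fun _ : ℕ × Fin U => (volume : Measure I)).map
    fun V => ⟨process w x V, isUrnPath_process w x V⟩

/-- The law of an environment with independent entries, equal to `1` with probability `p` and to
`-1` with probability `1 - p`. -/
def environmentLaw (U : ℕ) (p : I) : Measure (Environment U) :=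
  Measure.infinitePi fun _ : ℕ × Fin U => bernoulliMeasure (1 : ℤˣ) (-1) p

/-- The colour of the `(n + 1)`-st ball added to urn `u`. -/
def colour {U : ℕ} (r : UrnPath U) (n : ℕ) (u : Fin U) : Colour :=
  if r.1 (n + 1) u = r.1 n u + 1 then .black else .white

/-- From time `n₀` on, only balls of colour `d` are added to urn `u`. -/
def IsConformist {U : ℕ} (r : UrnPath U) (d : Colour) (n₀ : ℕ) (u : Fin U) : Prop :=
  ∀ n, n₀ ≤ n → colour r n u = d

/-- From time `n₀` on, the ball added to urn `u` has colour `d` whenever it is drawn out of all the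
urns combined, and the other colour whenever it is drawn out of urn `u` alone. -/
def IsNonconformist {U : ℕ} (x : Environment U) (r : UrnPath U) (d : Colour) (n₀ : ℕ)
    (u : Fin U) : Prop :=
  ∀ n, n₀ ≤ n → (x (n, u) = 1 → colour r n u = d) ∧ (x (n, u) = -1 → colour r n u ≠ d)

/-- From time `n₀` on, each urn is conformist or nonconformist with respect to the colour `d`. -/
def IsSuitableFrom {U : ℕ} (x : Environment U) (r : UrnPath U) (d : Colour) (n₀ : ℕ) : Prop :=
  ∀ u, IsConformist r d n₀ u ∨ IsNonconformist x r d n₀ u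

/-- The urn path `r` is `x`-suitable. -/
def IsSuitable {U : ℕ} (x : Environment U) (r : UrnPath U) : Prop :=
  ∃ d n₀, IsSuitableFrom x r d n₀

/-- The number of nonconformist urns. -/
def numNonconformist {U : ℕ} (x : Environment U) (r : UrnPath U) (d : Colour) (n₀ : ℕ) : ℕ :=
  {u | IsNonconformist x r d n₀ u}.ncard

/-- The Conformism Equation. It is required for every colour and time that witness the
suitability of `r`, so that it does not depend on how they are chosen. -/
def SatisfiesCE {U : ℕ} (p : I) (x : Environment U) (r : UrnPath U) : Prop :=
  ∀ d n₀, IsSuitableFrom x r d n₀ →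
    (1 - (p : ℝ)) * (numNonconformist x r d n₀ : ℝ) < (U : ℝ) / 2

end InteractingUrns

end

open Filter Topology
open scoped ENNReal

/-! Average over environment and driving numbers: the noise is then i.i.d. in time, and the
differences `D u` (black minus white in urn `u`) form a Markov chain. A draw made at difference `k`
gives the minority colour with probability at most `ρ ^ (-|k|)`. Hence everything rests on Lyapunov
functions decreasing in mean by at least a multiple of `ρ ^ (-|k|)`: they make these probabilities
summable in mean, so `|k| → ∞` and, by Borel–Cantelli, minority draws stop (`ae_escape`).

This is used twice. Since `p < 1/2`, solo draws dominate the motion of `D u`, which is pushed away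
from the origin; so solo draws of urn `u` eventually have a constant sign `s u` (`ae_diff_escape`,
`ae_exists_signs`). Once these signs are frozen, the total difference is itself a Markov chain on
the integers, with limiting drifts `(1 - p) * ∑ s ± p * U` at `±∞` (`ae_forced_escape`). It escapes
too, so combined draws settle on one colour `d`, which is suitability.

Escape to `+∞` requires the drift there to be strictly positive, and symmetrically at `-∞`. The
borderline of zero limiting drift is excluded by a Lyapunov function of linear growth and Fatou
(`exists_oneSided_step`). With `N` nonconformist urns, `∑ s = ±(U - 2 N)`, and the strict drift
condition is the Conformism Equation. Fubini returns to almost every fixed environment. -/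

namespace InteractingUrns

/-! ### Markov chains driven by independent noise, and Lyapunov functions. -/

section Chain

/-- Pairs of independent families on a product space are independent. -/
theorem iIndepFun_prodMk_prod {ι Ω Ω' α β : Type*} [MeasurableSpace Ω] [MeasurableSpace Ω']
    [MeasurableSpace α] [MeasurableSpace β] {μ : Measure Ω} {μ' : Measure Ω'}
    [IsProbabilityMeasure μ] [IsProbabilityMeasure μ']
    {f : ι → Ω → α} {g : ι → Ω' → β} (hf : iIndepFun f μ) (hg : iIndepFun g μ')
    (hfm : ∀ i, Measurable (f i)) (hgm : ∀ i, Measurable (g i)) :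
    iIndepFun (fun i (ω : Ω × Ω') => (f i ω.1, g i ω.2)) (μ.prod μ') := by
  have hm : ∀ i, Measurable (fun ω : Ω × Ω' => (f i ω.1, g i ω.2)) := fun i =>
    ((hfm i).comp measurable_fst).prodMk ((hgm i).comp measurable_snd)
  rw [iIndepFun_iff_iIndep]
  refine iIndepSets.iIndep (fun i => (hm i).comap_le)
    (fun i => {s | ∃ t ∈ Set.image2 (fun (A : Set α) (B : Set β) => A ×ˢ B) {A | MeasurableSet A}
      {B | MeasurableSet B}, (fun ω : Ω × Ω' => (f i ω.1, g i ω.2)) ⁻¹' t = s})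
    (fun i => isPiSystem_prod.comap _) (fun i => ?_) ?_
  · rw [← generateFrom_prod, MeasurableSpace.comap_generateFrom]
    rfl
  · rw [iIndepSets_iff]
    intro s F hF
    have hF' : ∀ i, ∃ A B, MeasurableSet A ∧ MeasurableSet B ∧
        (i ∈ s → F i = (f i ⁻¹' A) ×ˢ (g i ⁻¹' B)) := by
      intro i
      by_cases hi : i ∈ s
      · obtain ⟨t, ⟨A, hA, B, hB, rfl⟩, h⟩ := hF i hi
        exact ⟨A, B, hA, hB, fun _ => h.symm⟩
      · exact ⟨∅, ∅, .empty, .empty, fun h => absurd h hi⟩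
    choose A B hA hB hAB using hF'
    have h1 : (⋂ i ∈ s, F i) = (⋂ i ∈ s, f i ⁻¹' A i) ×ˢ (⋂ i ∈ s, g i ⁻¹' B i) := by
      ext ω
      simp only [Set.mem_iInter, Set.mem_prod]
      constructor
      · intro h
        exact ⟨fun i hi => ((hAB i hi) ▸ h i hi).1, fun i hi => ((hAB i hi) ▸ h i hi).2⟩
      · intro h i hi
        rw [hAB i hi]
        exact ⟨h.1 i hi, h.2 i hi⟩
    rw [h1, Measure.prod_prod,
      hf.meas_biInter (fun i _ => ⟨A i, hA i, rfl⟩), hg.meas_biInter (fun i _ => ⟨B i, hB i, rfl⟩),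
      ← Finset.prod_mul_distrib]
    refine Finset.prod_congr rfl fun i hi => ?_
    rw [hAB i hi, Measure.prod_prod]

variable {Ω E S : Type*}

/-- The Markov chain started from `s₀` with transitions `Φ`, driven by the noise `Y`. -/
def chain (Φ : S → E → S) (Y : ℕ → Ω → E) (s₀ : S) : ℕ → Ω → S
  | 0 => fun _ => s₀
  | n + 1 => fun ω => Φ (chain Φ Y s₀ n ω) (Y n ω)

theorem chain_succ (Φ : S → E → S) (Y : ℕ → Ω → E) (s₀ : S) (n : ℕ) (ω : Ω) :
    chain Φ Y s₀ (n + 1) ω = Φ (chain Φ Y s₀ n ω) (Y n ω) := rfl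

variable [MeasurableSpace E] [MeasurableSpace S] [Countable S]
  [MeasurableSingletonClass S]
  {Φ : S → E → S} {Y : ℕ → Ω → E} {s₀ : S}

/-- Only noise at times strictly below `n` enters the state at time `n`; the strictness is what
makes the state independent of `Y n`. -/
theorem measurable_chain_iSup (hΦ : ∀ s, Measurable (Φ s)) (n : ℕ) :
    Measurable[⨆ i ∈ Set.Iio n, MeasurableSpace.comap (Y i) inferInstance] (chain Φ Y s₀ n) := by
  induction n with
  | zero => exact measurable_const
  | succ n ih =>
    have h1 : Measurable[⨆ i ∈ Set.Iio (n + 1), MeasurableSpace.comap (Y i) inferInstance]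
        (chain Φ Y s₀ n) :=
      ih.mono (biSup_mono fun i hi => Nat.lt_succ_of_lt hi) le_rfl
    have h2 : Measurable[⨆ i ∈ Set.Iio (n + 1), MeasurableSpace.comap (Y i) inferInstance]
        (Y n) := by
      refine Measurable.mono (comap_measurable (Y n)) ?_ le_rfl
      exact le_biSup (fun i => MeasurableSpace.comap (Y i) inferInstance)
        (Set.mem_Iio.2 (Nat.lt_succ_self n))
    have h3 : Measurable fun q : S × E => Φ q.1 q.2 :=
      measurable_from_prod_countable_right fun s => hΦ s
    exact h3.comp (h1.prodMk h2)

variable [MeasurableSpace Ω] {P : Measure Ω} {ν : Measure E}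

theorem measurable_chain (hYm : ∀ n, Measurable (Y n)) (hΦ : ∀ s, Measurable (Φ s)) (n : ℕ) :
    Measurable (chain Φ Y s₀ n) :=
  (measurable_chain_iSup hΦ n).mono (iSup₂_le fun i _ => (hYm i).comap_le) le_rfl

/-- The Markov property: the state is independent of the current noise, which can be integrated out
with the state frozen. Countability of `S` reduces joint measurability to measurability of sections.
-/
theorem lintegral_chain [IsProbabilityMeasure P] [IsProbabilityMeasure ν] (hY : iIndepFun Y P)
    (hYm : ∀ n, MeasurePreserving (Y n) P ν)
    (hΦ : ∀ s, Measurable (Φ s)) {F : S → E → ℝ≥0∞} (hF : ∀ s, Measurable (F s)) (n : ℕ) :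
    ∫⁻ ω, F (chain Φ Y s₀ n ω) (Y n ω) ∂P = ∫⁻ ω, ∫⁻ y, F (chain Φ Y s₀ n ω) y ∂ν ∂P := by
  have hm := fun n => (hYm n).measurable
  have hX := measurable_chain (s₀ := s₀) hm hΦ n
  have hind : IndepFun (chain Φ Y s₀ n) (Y n) P := by
    rw [IndepFun_iff_Indep]
    have h := indep_iSup_of_disjoint (fun i => (hm i).comap_le) hY.iIndep
      (S := Set.Iio n) (T := {n}) (by simp)
    refine indep_of_indep_of_le_left (indep_of_indep_of_le_right h ?_) ?_
    · simp
    · exact (measurable_chain_iSup hΦ n).comap_le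
  have hF' : Measurable fun q : S × E => F q.1 q.2 :=
    measurable_from_prod_countable_right fun s => hF s
  calc ∫⁻ ω, F (chain Φ Y s₀ n ω) (Y n ω) ∂P
      = ∫⁻ q, F q.1 q.2 ∂(P.map fun ω => (chain Φ Y s₀ n ω, Y n ω)) := by
        rw [lintegral_map hF' (hX.prodMk (hm n))]
    _ = ∫⁻ q, F q.1 q.2 ∂((P.map (chain Φ Y s₀ n)).prod ν) := by
        rw [(indepFun_iff_map_prod_eq_prod_map_map hX.aemeasurable (hm n).aemeasurable).1 hind,
          (hYm n).map_eq]
    _ = ∫⁻ s, ∫⁻ y, F s y ∂ν ∂(P.map (chain Φ Y s₀ n)) := lintegral_prod _ hF'.aemeasurable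
    _ = _ := lintegral_map hF'.lintegral_prod_right' hX

/-- `h` is a nonnegative supersolution for the transitions `Φ` driven by noise of law `ν`, and
decreases in mean at least by `g`. -/
structure IsLyapunov (Φ : S → E → S) (ν : Measure E) (h g : S → ℝ≥0∞) : Prop where
  ne_top : ∀ s, h s ≠ ⊤
  drift : ∀ s, ∫⁻ y, h (Φ s y) ∂ν + g s ≤ h s

variable {h g : S → ℝ≥0∞} [IsProbabilityMeasure P] [IsProbabilityMeasure ν]

/-- The drift inequality, averaged over the state at each time, telescopes. -/
theorem IsLyapunov.sum_add_le (hL : IsLyapunov Φ ν h g) (hY : iIndepFun Y P)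
    (hYm : ∀ n, MeasurePreserving (Y n) P ν) (hΦ : ∀ s, Measurable (Φ s)) (n : ℕ) :
    ∑ i ∈ Finset.range n, ∫⁻ ω, g (chain Φ Y s₀ i ω) ∂P + ∫⁻ ω, h (chain Φ Y s₀ n ω) ∂P
      ≤ h s₀ := by
  induction n with
  | zero => simp [chain]
  | succ n ih =>
    refine le_trans ?_ ih
    have hX := measurable_chain (s₀ := s₀) (fun n => (hYm n).measurable) hΦ n
    have h1 : ∫⁻ ω, h (chain Φ Y s₀ (n + 1) ω) ∂P
        = ∫⁻ ω, ∫⁻ y, h (Φ (chain Φ Y s₀ n ω) y) ∂ν ∂P :=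
      lintegral_chain (F := fun s y => h (Φ s y)) hY hYm hΦ
        (fun s => (measurable_of_countable h).comp (hΦ s)) n
    rw [Finset.sum_range_succ, add_assoc, h1, add_comm (∫⁻ ω, g _ ∂P),
      ← lintegral_add_right _
        (show Measurable fun ω => g (chain Φ Y s₀ n ω) from (measurable_of_countable g).comp hX)]
    gcongr with ω
    exact hL.drift _

theorem IsLyapunov.tsum_le (hL : IsLyapunov Φ ν h g) (hY : iIndepFun Y P)
    (hYm : ∀ n, MeasurePreserving (Y n) P ν) (hΦ : ∀ s, Measurable (Φ s)) :
    ∑' i, ∫⁻ ω, g (chain Φ Y s₀ i ω) ∂P ≤ h s₀ :=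
  ENNReal.tsum_le_of_sum_range_le fun n =>
    le_trans le_self_add (hL.sum_add_le hY hYm hΦ n)

theorem IsLyapunov.ae_tendsto_zero (hL : IsLyapunov Φ ν h g) (hY : iIndepFun Y P)
    (hYm : ∀ n, MeasurePreserving (Y n) P ν) (hΦ : ∀ s, Measurable (Φ s)) :
    ∀ᵐ ω ∂P, Tendsto (fun n => g (chain Φ Y s₀ n ω)) atTop (𝓝 0) := by
  have hm : ∀ i, Measurable fun ω => g (chain Φ Y s₀ i ω) := fun i =>
    (measurable_of_countable g).comp (measurable_chain (fun n => (hYm n).measurable) hΦ i)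
  have h1 : ∫⁻ ω, ∑' i, g (chain Φ Y s₀ i ω) ∂P ≠ ⊤ := by
    rw [lintegral_tsum fun i => (hm i).aemeasurable]
    exact ne_top_of_le_ne_top (hL.ne_top s₀) (hL.tsum_le hY hYm hΦ)
  filter_upwards [ae_lt_top (Measurable.tsum hm) h1] with ω hω
  exact ENNReal.tendsto_atTop_zero_of_tsum_ne_top hω.ne

/-- Borel–Cantelli: by the Markov property the event at time `n` has probability at most `C` times
the mean of `g`, and these means are summable. -/
theorem IsLyapunov.ae_eventually_notMem (hL : IsLyapunov Φ ν h g) (hY : iIndepFun Y P)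
    (hYm : ∀ n, MeasurePreserving (Y n) P ν) (hΦ : ∀ s, Measurable (Φ s))
    {B : S → Set E} (hB : ∀ s, MeasurableSet (B s)) {C : ℝ≥0∞} (hC : C ≠ ⊤)
    (hBg : ∀ s, ν (B s) ≤ C * g s) :
    ∀ᵐ ω ∂P, ∀ᶠ n in atTop, Y n ω ∉ B (chain Φ Y s₀ n ω) := by
  refine MeasureTheory.ae_eventually_notMem (s := fun n => {ω | Y n ω ∈ B (chain Φ Y s₀ n ω)}) ?_
  have hm : ∀ n, MeasurableSet {ω | Y n ω ∈ B (chain Φ Y s₀ n ω)} := by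
    intro n
    have h3 : MeasurableSet {q : S × E | q.2 ∈ B q.1} := by
      have : {q : S × E | q.2 ∈ B q.1} = ⋃ s, {s} ×ˢ B s := by
        ext ⟨s, y⟩; simp
      rw [this]
      exact MeasurableSet.iUnion fun s => (measurableSet_singleton s).prod (hB s)
    exact h3.preimage
      ((measurable_chain (fun n => (hYm n).measurable) hΦ n).prodMk (hYm n).measurable)
  have h1 : ∀ n, P {ω | Y n ω ∈ B (chain Φ Y s₀ n ω)}
      ≤ C * ∫⁻ ω, g (chain Φ Y s₀ n ω) ∂P := by
    intro n
    calc P {ω | Y n ω ∈ B (chain Φ Y s₀ n ω)}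
        = ∫⁻ ω, (B (chain Φ Y s₀ n ω)).indicator 1 (Y n ω) ∂P := by
          rw [← lintegral_indicator_one (hm n)]
          rfl
      _ = ∫⁻ ω, ∫⁻ y, (B (chain Φ Y s₀ n ω)).indicator 1 y ∂ν ∂P :=
          lintegral_chain (F := fun s => (B s).indicator 1) hY hYm hΦ
            (fun s => measurable_one.indicator (hB s)) n
      _ ≤ ∫⁻ ω, C * g (chain Φ Y s₀ n ω) ∂P := by
          gcongr with ω
          rw [lintegral_indicator_one (hB _)]
          exact hBg _
      _ = _ := lintegral_const_mul' _ _ hC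
  refine ne_top_of_le_ne_top ?_ (ENNReal.tsum_le_tsum h1)
  rw [ENNReal.tsum_mul_left]
  exact ENNReal.mul_ne_top hC (ne_top_of_le_ne_top (hL.ne_top s₀) (hL.tsum_le hY hYm hΦ))

/-- The mean of `h` along the chain never exceeds `h s₀`, so by Fatou its liminf is almost surely
finite. -/
theorem IsLyapunov.ae_not_tendsto_top (hL : IsLyapunov Φ ν h g) (hY : iIndepFun Y P)
    (hYm : ∀ n, MeasurePreserving (Y n) P ν) (hΦ : ∀ s, Measurable (Φ s)) :
    ∀ᵐ ω ∂P, ¬ Tendsto (fun n => h (chain Φ Y s₀ n ω)) atTop (𝓝 ⊤) := by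
  have hm : ∀ i, Measurable fun ω => h (chain Φ Y s₀ i ω) := fun i =>
    (measurable_of_countable h).comp (measurable_chain (fun n => (hYm n).measurable) hΦ i)
  have h1 : ∫⁻ ω, liminf (fun n => h (chain Φ Y s₀ n ω)) atTop ∂P ≠ ⊤ := by
    refine ne_top_of_le_ne_top (hL.ne_top s₀) ((lintegral_liminf_le hm).trans ?_)
    refine liminf_le_of_frequently_le' (Frequently.of_forall fun n => ?_)
    exact le_trans le_add_self (hL.sum_add_le hY hYm hΦ n)
  filter_upwards [ae_lt_top (Measurable.liminf hm) h1] with ω hω ht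
  exact hω.ne ht.liminf_eq

end Chain

/-! ### Lyapunov functions for integer chains with bounded increments. -/

section OneStep

variable {E : Type*} [MeasurableSpace E] {ν : Measure E} [IsProbabilityMeasure ν] {ξ : E → ℤ}
  {U : ℕ}

theorem integrable_comp_of_bdd (hξ : Measurable ξ) (hU : ∀ y, |ξ y| ≤ U) (f : ℤ → ℝ) :
    Integrable (fun y => f (ξ y)) ν := by
  refine Integrable.of_bound (C := ∑ j ∈ Finset.Icc (-U : ℤ) U, |f j|)
    ((measurable_of_countable f).comp hξ).aestronglyMeasurable (ae_of_all _ fun y => ?_)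
  exact Finset.single_le_sum (f := fun j => |f j|) (fun j _ => abs_nonneg _)
    (Finset.mem_Icc.2 (abs_le.1 (hU y)))

theorem integral_exp_mul_le (hξ : Measurable ξ) (hU : ∀ y, |ξ y| ≤ U) {t : ℝ}
    (ht : |t| * U ≤ 1) :
    ∫ y, Real.exp (t * ξ y) ∂ν ≤ 1 + t * ∫ y, (ξ y : ℝ) ∂ν + t ^ 2 * U ^ 2 := by
  have hi := integrable_comp_of_bdd (ν := ν) hξ hU fun k => (k : ℝ)
  have h1 : ∫ y, Real.exp (t * ξ y) ∂ν ≤ ∫ y, (1 + t * ξ y + t ^ 2 * U ^ 2) ∂ν := by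
    refine integral_mono (integrable_comp_of_bdd hξ hU fun k => Real.exp (t * k))
      (((integrable_const _).add (hi.const_mul t)).add (integrable_const _)) fun y => ?_
    have hy : |(ξ y : ℝ)| ≤ U := by exact_mod_cast hU y
    have h2 : |t * ξ y| ≤ 1 := by
      rw [abs_mul]
      exact (mul_le_mul_of_nonneg_left hy (abs_nonneg t)).trans ht
    have h3 := (abs_le.1 (Real.abs_exp_sub_one_sub_id_le h2)).2
    have h4 : (t * ξ y) ^ 2 ≤ t ^ 2 * U ^ 2 := by
      rw [mul_pow]
      exact mul_le_mul_of_nonneg_left (sq_le_sq.2 (by simpa using hy)) (sq_nonneg t)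
    change Real.exp (t * ξ y) ≤ 1 + t * ξ y + t ^ 2 * U ^ 2
    linarith
  have hi1 : Integrable (fun y => 1 + t * (ξ y : ℝ)) ν := (integrable_const _).add (hi.const_mul t)
  rw [integral_add hi1 (integrable_const _), integral_add (integrable_const _) (hi.const_mul t), integral_const_mul] at h1
  simpa using h1

/-- A strict form of Jensen's inequality for the exponential. -/
theorem le_integral_exp_neg (hξ : Measurable ξ) (hU : ∀ y, |ξ y| ≤ U) {t ε : ℝ} (ht : 0 < t)
    (hε : ε ≤ ν.real {y | ξ y ≤ -1}) :
    1 - t * ∫ y, (ξ y : ℝ) ∂ν + (Real.exp t - 1 - t) * ε ≤ ∫ y, Real.exp (-t * ξ y) ∂ν := by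
  have hi := integrable_comp_of_bdd (ν := ν) hξ hU fun k => (k : ℝ)
  have hs : MeasurableSet {y | ξ y ≤ -1} := hξ measurableSet_Iic
  have hκ : 0 < Real.exp t - 1 - t := by linarith [Real.add_one_lt_exp ht.ne']
  have h1 : ∫ y, (1 - t * ξ y + (Real.exp t - 1 - t) * {y | ξ y ≤ -1}.indicator 1 y) ∂ν
      ≤ ∫ y, Real.exp (-t * ξ y) ∂ν := by
    refine integral_mono (((integrable_const _).sub (hi.const_mul t)).add
      (((integrable_const _).indicator hs).const_mul _))
      (integrable_comp_of_bdd hξ hU fun k => Real.exp (-t * k)) fun y => ?_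
    by_cases hy : ξ y ≤ -1
    · have hy' : (ξ y : ℝ) ≤ -1 := by exact_mod_cast hy
      have h2 : 0 ≤ t * (-ξ y - 1) := mul_nonneg ht.le (by linarith)
      -- The gain over the tangent line at the origin is smallest at `ξ = -1`, where it is `exp t -
      -- 1 - t`.
      have h3 : Real.exp (-t * ξ y) = Real.exp t * Real.exp (t * (-ξ y - 1)) := by
        rw [← Real.exp_add]; ring_nf
      have h4 := Real.add_one_le_exp (t * (-ξ y - 1))
      have h5 : 1 ≤ Real.exp t := Real.one_le_exp ht.le
      simp only [Set.indicator, Set.mem_ofPred_eq, hy, if_true, Pi.one_apply]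
      nlinarith
    · have h4 := Real.add_one_le_exp (-t * ξ y)
      simp only [Set.indicator, Set.mem_ofPred_eq, hy, if_false]
      linarith
  have hi1 : Integrable (fun y => 1 - t * (ξ y : ℝ)) ν := (integrable_const _).sub (hi.const_mul t)
  have hi2 : Integrable ({y | ξ y ≤ -1}.indicator (1 : E → ℝ)) ν :=
    (integrable_const _).indicator hs
  rw [integral_add hi1 (hi2.const_mul _), integral_sub (integrable_const _) (hi.const_mul t), integral_const_mul, integral_const_mul,
    integral_indicator_one hs] at h1
  have h6 := mul_le_mul_of_nonneg_left hε hκ.le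
  simp only [integral_const, probReal_univ, smul_eq_mul, mul_one] at h1
  linarith

/-- A Lyapunov function for integer chains that are pushed away from the origin. -/
noncomputable def twoSided (t R : ℝ) (K : ℕ) (k : ℤ) : ℝ :=
  min (Real.exp (-t * k.natAbs)) (Real.exp (-t * (K - 1)) -
    (Real.exp (-t * (K - 1)) - Real.exp (-t * K)) / R ^ K * R ^ (min k.natAbs K))

theorem twoSided_neg (t R : ℝ) (K : ℕ) (k : ℤ) : twoSided t R K (-k) = twoSided t R K k := by
  simp [twoSided]

theorem twoSided_coeff_pos {t R : ℝ} (K : ℕ) (ht : 0 < t) (hR : 1 ≤ R) :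
    0 < (Real.exp (-t * (K - 1)) - Real.exp (-t * K)) / R ^ K := by
  have : Real.exp (-t * K) < Real.exp (-t * (K - 1)) := Real.exp_lt_exp.2 (by nlinarith)
  have : 0 < R ^ K := by positivity
  apply div_pos <;> linarith

/-- The branches agree at `|k| = K`; beyond, the second is frozen at `exp (-t * K)`, and below it is
at most `exp (-t * (K - 1))`. So the minimum switches at `K`, while each branch remains a global
upper bound, convenient for steps crossing `K`. -/
theorem twoSided_of_le {t R : ℝ} {K : ℕ} (ht : 0 < t) (hR : 1 ≤ R) {k : ℤ} (hk : K ≤ k.natAbs) :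
    twoSided t R K k = Real.exp (-t * k.natAbs) := by
  refine min_eq_left ?_
  have : (K : ℝ) ≤ k.natAbs := by exact_mod_cast hk
  rw [min_eq_right hk, div_mul_cancel₀ _ (by positivity)]
  simp only [sub_sub_cancel]
  exact Real.exp_le_exp.2 (by nlinarith)

theorem twoSided_of_lt {t R : ℝ} {K : ℕ} (ht : 0 < t) (hR : 1 ≤ R) {k : ℤ} (hk : k.natAbs < K) :
    twoSided t R K k = Real.exp (-t * (K - 1)) -
      (Real.exp (-t * (K - 1)) - Real.exp (-t * K)) / R ^ K * R ^ k.natAbs := by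
  rw [twoSided, min_eq_left hk.le (b := K)]
  refine min_eq_right ?_
  have h1 : (k.natAbs : ℝ) + 1 ≤ K := by exact_mod_cast hk
  have h2 : Real.exp (-t * (K - 1)) ≤ Real.exp (-t * k.natAbs) := Real.exp_le_exp.2 (by nlinarith)
  have h3 := mul_pos (twoSided_coeff_pos K ht hR) (show 0 < R ^ k.natAbs by positivity)
  linarith

theorem twoSided_nonneg {t R : ℝ} (K : ℕ) (ht : 0 < t) (hR : 1 ≤ R) (k : ℤ) :
    0 ≤ twoSided t R K k := by
  refine le_min (Real.exp_pos _).le ?_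
  have h1 : R ^ (min k.natAbs K) ≤ R ^ K := pow_le_pow_right₀ hR (min_le_right _ _)
  have h2 := mul_le_mul_of_nonneg_left h1 (twoSided_coeff_pos K ht hR).le
  rw [div_mul_cancel₀ _ (by positivity)] at h2
  linarith [Real.exp_pos (-t * K)]

/-- Beyond `K` the outward drift `a` makes the exponential decrease. Below `K` nothing is known
about the drift, but an outward step of probability at least `ε` multiplies `R ^ |k|` by at least
`R`, and `R * ε ≥ 2` outweighs all other steps, whose contribution is simply dropped. -/
theorem twoSided_step_of_nonneg (hξ : Measurable ξ) (hU : ∀ y, |ξ y| ≤ U) {t R a ε : ℝ} {K : ℕ}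
    (ht : 0 < t) (htU : t * U ≤ 1) (hta : t * U ^ 2 ≤ a / 2) (hR : 1 ≤ R) (hRε : 2 ≤ R * ε)
    {k : ℤ} (hk : 0 ≤ k) (hfar : K ≤ k → a ≤ ∫ y, (ξ y : ℝ) ∂ν)
    (hmid : k < K → ε ≤ ν.real {y | 1 ≤ ξ y}) :
    ∫ y, twoSided t R K (k + ξ y) ∂ν + min (t * (a / 2))
      ((Real.exp (-t * (K - 1)) - Real.exp (-t * K)) / R ^ K) * Real.exp (-t * k.natAbs)
      ≤ twoSided t R K k := by
  have hkr : ((k.natAbs : ℕ) : ℝ) = k := by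
    rw [Nat.cast_natAbs, abs_of_nonneg hk]
  have hψi := integrable_comp_of_bdd (ν := ν) hξ hU fun j => twoSided t R K (k + j)
  set δ := (Real.exp (-t * (K - 1)) - Real.exp (-t * K)) / R ^ K with hδ
  have hδ0 : 0 < δ := twoSided_coeff_pos K ht hR
  rcases le_or_gt (K : ℤ) k with h | h
  · rw [twoSided_of_le ht hR (by omega), hkr]
    have h1 : ∫ y, twoSided t R K (k + ξ y) ∂ν
        ≤ ∫ y, Real.exp (-t * k) * Real.exp (-t * ξ y) ∂ν := by
      refine integral_mono hψi ((integrable_comp_of_bdd hξ hU fun j =>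
        Real.exp (-t * j)).const_mul _) fun y => ?_
      refine (min_le_left _ _).trans ?_
      rw [← Real.exp_add]
      refine Real.exp_le_exp.2 ?_
      have : ((k + ξ y : ℤ) : ℝ) ≤ ((k + ξ y).natAbs : ℕ) := by
        rw [Nat.cast_natAbs]
        exact_mod_cast le_abs_self _
      push_cast at this
      nlinarith
    rw [integral_const_mul] at h1
    have h2 := integral_exp_mul_le (ν := ν) hξ hU (t := -t) (by rwa [abs_neg, abs_of_pos ht])
    have h3 := hfar h
    have h4 : ∫ y, Real.exp (-t * ξ y) ∂ν ≤ 1 - t * (a / 2) := by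
      have := mul_le_mul_of_nonneg_left h3 ht.le
      have := mul_le_mul_of_nonneg_left hta ht.le
      nlinarith
    have h5 := mul_le_mul_of_nonneg_left h4 (Real.exp_pos (-t * k)).le
    have h6 := mul_le_mul_of_nonneg_right (min_le_left (t * (a / 2)) δ) (Real.exp_pos (-t * k)).le
    nlinarith
  · rw [twoSided_of_lt ht hR (by omega), ← hδ]
    have hs : MeasurableSet {y | 1 ≤ ξ y} := hξ measurableSet_Ici
    have h1 : ∫ y, twoSided t R K (k + ξ y) ∂ν ≤ ∫ y, (Real.exp (-t * (K - 1)) -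
        δ * R ^ (k.natAbs + 1) * {y | 1 ≤ ξ y}.indicator 1 y) ∂ν := by
      refine integral_mono hψi ((integrable_const _).sub
        (((integrable_const _).indicator hs).const_mul _)) fun y => ?_
      refine (min_le_right _ _).trans ?_
      refine sub_le_sub_left ?_ _
      rw [mul_assoc]
      refine mul_le_mul_of_nonneg_left ?_ hδ0.le
      by_cases hy : 1 ≤ ξ y
      · simp only [Set.indicator, Set.mem_ofPred_eq, hy, if_true, Pi.one_apply, mul_one]
        exact pow_le_pow_right₀ hR (by omega)
      · simp only [Set.indicator, Set.mem_ofPred_eq, hy, if_false, mul_zero]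
        positivity
    rw [integral_sub (integrable_const _) (((integrable_const _).indicator hs).const_mul _),
      integral_const_mul, integral_indicator_one hs] at h1
    simp only [integral_const, probReal_univ, smul_eq_mul, one_mul] at h1
    have h2 := hmid h
    have hRk : 1 ≤ R ^ k.natAbs := one_le_pow₀ hR
    have h3 : 2 * R ^ k.natAbs ≤ R ^ (k.natAbs + 1) * ν.real {y | 1 ≤ ξ y} := by
      rw [pow_succ, mul_comm, mul_assoc]
      exact mul_le_mul_of_nonneg_left (hRε.trans (by gcongr)) (by positivity)
    have h4 := mul_le_mul_of_nonneg_left h3 hδ0.le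
    have h5 : min (t * (a / 2)) δ * Real.exp (-t * k.natAbs) ≤ δ * 1 := by
      have : Real.exp (-t * k.natAbs) ≤ 1 := by
        rw [Real.exp_le_one_iff]
        have : (0 : ℝ) ≤ k.natAbs := Nat.cast_nonneg _
        nlinarith
      exact mul_le_mul (min_le_right _ _) this (Real.exp_pos _).le hδ0.le
    have h6 := mul_le_mul_of_nonneg_left hRk hδ0.le
    nlinarith

theorem inv_pow_natAbs_le {ρ t : ℝ} (hρ : 1 < ρ) (ht : t ≤ Real.log ρ) (k : ℤ) :
    (ρ ^ k.natAbs)⁻¹ ≤ Real.exp (-t * k.natAbs) := by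
  rw [← Real.exp_log (show 0 < ρ by linarith), ← Real.exp_nat_mul, ← Real.exp_neg]
  refine Real.exp_le_exp.2 ?_
  have : (0 : ℝ) ≤ k.natAbs := Nat.cast_nonneg _
  nlinarith

theorem exists_twoSided_step (E : Type*) [MeasurableSpace E] {U : ℕ} (hU : 1 ≤ U) {ρ a ε : ℝ}
    (hρ : 1 < ρ) (ha : 0 < a) (hε : 0 < ε) (K : ℕ) :
    ∃ (ψ : ℤ → ℝ) (c : ℝ), 0 < c ∧ (∀ k, 0 ≤ ψ k) ∧
      ∀ (ν : Measure E) [IsProbabilityMeasure ν] (ξ : E → ℤ) (k : ℤ), Measurable ξ →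
        (∀ y, |ξ y| ≤ U) →
        (0 ≤ k → K ≤ k → a ≤ ∫ y, (ξ y : ℝ) ∂ν) → (0 ≤ k → k < K → ε ≤ ν.real {y | 1 ≤ ξ y}) →
        (k ≤ 0 → k ≤ -K → ∫ y, (ξ y : ℝ) ∂ν ≤ -a) →
        (k ≤ 0 → -K < k → ε ≤ ν.real {y | ξ y ≤ -1}) →
        ∫ y, ψ (k + ξ y) ∂ν + c * (ρ ^ k.natAbs)⁻¹ ≤ ψ k := by
  have hU0 : (0 : ℝ) < U := by exact_mod_cast hU
  -- `log ρ` makes `exp (-t * |k|)` dominate `ρ ^ (-|k|)`, `1 / U` permits the quadratic bound for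
  -- `exp`, and the last term keeps the quadratic error below half of the drift term.
  obtain ⟨t, ht0, ht⟩ : ∃ t : ℝ, 0 < t ∧ t ≤ min (Real.log ρ) (min (1 / U) (a / 2 / U ^ 2)) :=
    ⟨_, lt_min (Real.log_pos hρ) (lt_min (by positivity) (by positivity)), le_rfl⟩
  obtain ⟨ht1, ht2, ht3⟩ := (le_min_iff.1 ht).imp_right le_min_iff.1
  rw [le_div_iff₀ (by positivity)] at ht2 ht3
  obtain ⟨R, hR1, hR2⟩ : ∃ R : ℝ, 1 ≤ R ∧ 2 ≤ R * ε :=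
    ⟨max 1 (2 / ε), le_max_left _ _, (div_le_iff₀ hε).1 (le_max_right _ _)⟩
  refine ⟨twoSided t R K, min (t * (a / 2))
      ((Real.exp (-t * (K - 1)) - Real.exp (-t * K)) / R ^ K),
    lt_min (by positivity) (twoSided_coeff_pos K ht0 hR1), twoSided_nonneg K ht0 hR1, ?_⟩
  intro ν _ ξ k hξ hb h1 h2 h3 h4
  have hc : 0 ≤ min (t * (a / 2)) ((Real.exp (-t * (K - 1)) - Real.exp (-t * K)) / R ^ K) :=
    (lt_min (by positivity) (twoSided_coeff_pos K ht0 hR1)).le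
  have h5 := mul_le_mul_of_nonneg_left (inv_pow_natAbs_le hρ ht1 k) hc
  rcases le_total 0 k with hk | hk
  · have := twoSided_step_of_nonneg (ν := ν) hξ hb ht0 ht2 ht3 hR1 hR2 hk (h1 hk) (h2 hk)
    linarith
  · have := twoSided_step_of_nonneg (ν := ν) (ξ := fun y => -ξ y) (K := K) (k := -k) (a := a)
      (ε := ε) hξ.neg (by simpa using hb) ht0 ht2 ht3 hR1 hR2 (by omega)
      (fun h => by
        push_cast
        rw [integral_neg]
        linarith [h3 hk (by omega)])
      (fun h => by
        refine (h4 hk (by omega)).trans (le_of_eq ?_)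
        congr 1
        ext y
        simp only [Set.mem_ofPred_eq]
        omega)
    simp only [← neg_add, twoSided_neg, Int.natAbs_neg] at this
    linarith

/-- On the positive side only a nonpositive drift is assumed. There `ψ` is linear minus `exp (-t *
k)`: the linear part does not increase in mean, and strict Jensen makes the concave correction lose
a multiple of `exp (-t * k)`. The bound `k ≤ ψ k` is what later rules out escape to `+∞`. -/
theorem exists_oneSided_step (E : Type*) [MeasurableSpace E] {U : ℕ} (hU : 1 ≤ U) {ρ a ε : ℝ}
    (hρ : 1 < ρ) (ha : 0 < a) (hε : 0 < ε) :
    ∃ (ψ : ℤ → ℝ) (c : ℝ), 0 < c ∧ (∀ k, 0 ≤ ψ k) ∧ (∀ k : ℤ, (k : ℝ) ≤ ψ k) ∧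
      ∀ (ν : Measure E) [IsProbabilityMeasure ν] (ξ : E → ℤ) (k : ℤ), Measurable ξ →
        (∀ y, |ξ y| ≤ U) →
        (k ≤ 0 → ∫ y, (ξ y : ℝ) ∂ν ≤ -a) →
        (0 < k → ∫ y, (ξ y : ℝ) ∂ν ≤ 0 ∧ ε ≤ ν.real {y | ξ y ≤ -1}) →
        ∫ y, ψ (k + ξ y) ∂ν + c * (ρ ^ k.natAbs)⁻¹ ≤ ψ k := by
  have hU0 : (0 : ℝ) < U := by exact_mod_cast hU
  obtain ⟨t, ht0, ht⟩ : ∃ t : ℝ, 0 < t ∧ t ≤ min (Real.log ρ) (min ((1 / 2) / U) (a / 2 / U ^ 2)) :=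
    ⟨_, lt_min (Real.log_pos hρ) (lt_min (by positivity) (by positivity)), le_rfl⟩
  obtain ⟨ht1, ht2, ht3⟩ := (le_min_iff.1 ht).imp_right le_min_iff.1
  rw [le_div_iff₀ (by positivity)] at ht2 ht3
  -- Chosen so that each branch of `ψ` bounds `ψ` across the junction: for `-U ≤ k ≤ 0`, where `|t *
  -- k| ≤ 1 / 2`, both are compared with `A + (1 + 2 * t) * k`.
  obtain ⟨A, hA⟩ : ∃ A : ℝ, A * t = 2 + 4 * t := ⟨(2 + 4 * t) / t, by field_simp⟩
  have hA0 : 0 < A := by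
    by_contra h
    push Not at h
    nlinarith
  set ψ : ℤ → ℝ := fun k => if k ≤ 0 then A * Real.exp (t * k) else
    A + 1 + k - Real.exp (-t * k) with hψ
  have hψa : ∀ k : ℤ, ψ k ≤ A * Real.exp (t * k) := by
    intro k
    by_cases hk : k ≤ 0
    · simp [hψ, hk]
    · simp only [hψ, hk, if_false]
      have hk' : (0 : ℝ) < k := by exact_mod_cast not_le.1 hk
      have h1 := mul_le_mul_of_nonneg_left (Real.add_one_le_exp (t * k)) hA0.le
      have h2 := Real.add_one_le_exp (-t * k)
      have h3 : A * (t * k + 1) = (2 + 4 * t) * k + A := by rw [← hA]; ring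
      nlinarith [mul_pos ht0 hk']
  have hψb : ∀ k : ℤ, -(U : ℤ) ≤ k → ψ k ≤ A + 1 + k - Real.exp (-t * k) := by
    intro k hkU
    by_cases hk : k ≤ 0
    · simp only [hψ, hk, if_true]
      have hk' : (k : ℝ) ≤ 0 := by exact_mod_cast hk
      have hkU' : -(U : ℝ) ≤ k := by exact_mod_cast hkU
      have h0 : -(1 / 2) ≤ t * k := by nlinarith
      have h0' : t * k ≤ 0 := by nlinarith
      have h1 := (abs_le.1 (Real.abs_exp_sub_one_sub_id_le (x := t * k)
        (abs_le.2 ⟨by linarith, by linarith⟩))).2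
      have h2 := (abs_le.1 (Real.abs_exp_sub_one_sub_id_le (x := -t * k)
        (abs_le.2 ⟨by linarith, by linarith⟩))).2
      have h3 : Real.exp (t * k) ≤ 1 + t * k / 2 := by nlinarith
      have h4 : Real.exp (-t * k) ≤ 1 - 2 * (t * k) := by nlinarith
      have h5 := mul_le_mul_of_nonneg_left h3 hA0.le
      have h6 : A * (1 + t * k / 2) = A + (2 + 4 * t) * k / 2 := by rw [← hA]; ring
      linarith
    · simp [hψ, hk]
  have hκ : 0 < Real.exp t - 1 - t := by linarith [Real.add_one_lt_exp ht0.ne']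
  have hcpos : 0 < min (A * (t * (a / 2))) ((Real.exp t - 1 - t) * ε) :=
    lt_min (by positivity) (by positivity)
  refine ⟨ψ, min (A * (t * (a / 2))) ((Real.exp t - 1 - t) * ε), hcpos, ?_, ?_, ?_⟩
  · intro k
    by_cases hk : k ≤ 0
    · simp only [hψ, hk, if_true]; positivity
    · simp only [hψ, hk, if_false]
      have hk' : (0 : ℝ) < k := by exact_mod_cast not_le.1 hk
      have : Real.exp (-t * k) ≤ 1 := Real.exp_le_one_iff.2 (by nlinarith)
      linarith
  · intro k
    by_cases hk : k ≤ 0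
    · simp only [hψ, hk, if_true]
      have hk' : (k : ℝ) ≤ 0 := by exact_mod_cast hk
      exact hk'.trans (by positivity)
    · simp only [hψ, hk, if_false]
      have hk' : (0 : ℝ) < k := by exact_mod_cast not_le.1 hk
      have : Real.exp (-t * k) ≤ 1 := Real.exp_le_one_iff.2 (by nlinarith)
      linarith
  intro ν _ ξ k hξ hb h1 h2
  have hψi := integrable_comp_of_bdd (ν := ν) hξ hb fun j => ψ (k + j)
  have hi := integrable_comp_of_bdd (ν := ν) hξ hb fun k => (k : ℝ)
  have hg := mul_le_mul_of_nonneg_left (inv_pow_natAbs_le hρ ht1 k) hcpos.le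
  by_cases hk : k ≤ 0
  · have hkr : ((k.natAbs : ℕ) : ℝ) = -k := by
      rw [Nat.cast_natAbs, abs_of_nonpos hk, Int.cast_neg]
    have h3 : ∫ y, ψ (k + ξ y) ∂ν ≤ ∫ y, A * Real.exp (t * k) * Real.exp (t * ξ y) ∂ν := by
      refine integral_mono hψi ((integrable_comp_of_bdd hξ hb fun j =>
        Real.exp (t * j)).const_mul _) fun y => ?_
      refine (hψa _).trans (le_of_eq ?_)
      rw [mul_assoc, ← Real.exp_add]
      push_cast
      ring_nf
    rw [integral_const_mul] at h3
    have h4 := integral_exp_mul_le (ν := ν) hξ hb (t := t) (by rw [abs_of_pos ht0]; linarith)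
    have h5 : ∫ y, Real.exp (t * ξ y) ∂ν ≤ 1 - t * (a / 2) := by
      have := mul_le_mul_of_nonneg_left (h1 hk) ht0.le
      have := mul_le_mul_of_nonneg_left ht3 ht0.le
      nlinarith
    have h6 := mul_le_mul_of_nonneg_left h5 (show 0 ≤ A * Real.exp (t * k) by positivity)
    have h7 := mul_le_mul_of_nonneg_right
      (min_le_left (A * (t * (a / 2))) ((Real.exp t - 1 - t) * ε)) (Real.exp_pos (t * k)).le
    rw [hkr, neg_mul_neg] at hg
    have h8 : ψ k = A * Real.exp (t * k) := by simp [hψ, hk]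
    rw [h8]
    nlinarith
  · have hk' : 0 < k := not_le.1 hk
    have hkr : ((k.natAbs : ℕ) : ℝ) = k := by
      rw [Nat.cast_natAbs, abs_of_pos hk']
    have hie := integrable_comp_of_bdd (ν := ν) hξ hb fun k => Real.exp (-t * k)
    have h3 : ∫ y, ψ (k + ξ y) ∂ν
        ≤ ∫ y, (A + 1 + k + ξ y - Real.exp (-t * k) * Real.exp (-t * ξ y)) ∂ν := by
      refine integral_mono hψi (((integrable_const _).add hi).sub (hie.const_mul _)) fun y => ?_
      refine (hψb _ ?_).trans (le_of_eq ?_)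
      · have := (abs_le.1 (hb y)).1
        omega
      · rw [← Real.exp_add]
        push_cast
        ring_nf
    have hi1 : Integrable (fun y => A + 1 + k + (ξ y : ℝ)) ν := (integrable_const _).add hi
    rw [integral_sub hi1 (hie.const_mul _),
      integral_add (integrable_const _) hi, integral_const_mul] at h3
    simp only [integral_const, probReal_univ, smul_eq_mul, one_mul] at h3
    obtain ⟨h4, h5⟩ := h2 hk'
    have h6 := le_integral_exp_neg hξ hb ht0 h5
    have h7 : 1 + (Real.exp t - 1 - t) * ε ≤ ∫ y, Real.exp (-t * ξ y) ∂ν := by nlinarith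
    have h8 := mul_le_mul_of_nonneg_left h7 (Real.exp_pos (-t * k)).le
    have h9 := mul_le_mul_of_nonneg_right
      (min_le_right (A * (t * (a / 2))) ((Real.exp t - 1 - t) * ε)) (Real.exp_pos (-t * k)).le
    rw [hkr] at hg
    have h10 : ψ k = A + 1 + k - Real.exp (-t * k) := by simp [hψ, hk]
    rw [h10]
    nlinarith

end OneStep

/-! ### Escape to infinity and the end of rare events. -/

section Escape

variable {Ω E S : Type*} [MeasurableSpace E] {ν : Measure E} {Φ : S → E → S}

theorem isLyapunov_ofReal {h g : S → ℝ} (hh : ∀ s, 0 ≤ h s) (hg : ∀ s, 0 ≤ g s)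
    (hi : ∀ s, Integrable (fun y => h (Φ s y)) ν)
    (hd : ∀ s, ∫ y, h (Φ s y) ∂ν + g s ≤ h s) :
    IsLyapunov Φ ν (fun s => ENNReal.ofReal (h s)) (fun s => ENNReal.ofReal (g s)) where
  ne_top _ := ENNReal.ofReal_ne_top
  drift s := by
    rw [← ofReal_integral_eq_lintegral_ofReal (hi s) (ae_of_all _ fun y => hh _),
      ← ENNReal.ofReal_add (integral_nonneg fun y => hh _) (hg s)]
    exact ENNReal.ofReal_le_ofReal (hd s)

variable [MeasurableSpace Ω] [MeasurableSpace S] [Countable S] [MeasurableSingletonClass S]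
  {P : Measure Ω} [IsProbabilityMeasure P] [IsProbabilityMeasure ν] {Y : ℕ → Ω → E} {s₀ : S}

/-- A Lyapunov function with decrease of order `ρ ^ (-|L|)` forces `|L|` to infinity, and events
of conditional probability of order `ρ ^ (-|L|)` to occur finitely often. -/
theorem ae_escape (hY : iIndepFun Y P) (hYm : ∀ n, MeasurePreserving (Y n) P ν)
    (hΦ : ∀ s, Measurable (Φ s)) {L : S → ℤ} {ψ : ℤ → ℝ} {ρ c : ℝ} (hρ : 1 < ρ) (hc : 0 < c)
    (hψ : ∀ k, 0 ≤ ψ k) (hi : ∀ s, Integrable (fun y => ψ (L (Φ s y))) ν)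
    (hd : ∀ s, ∫ y, ψ (L (Φ s y)) ∂ν + c * (ρ ^ (L s).natAbs)⁻¹ ≤ ψ (L s))
    {B : S → Set E} (hB : ∀ s, MeasurableSet (B s)) {C : ℝ≥0∞} (hC : C ≠ ⊤)
    (hBν : ∀ s, ν (B s) ≤ C * ENNReal.ofReal (ρ ^ (L s).natAbs)⁻¹) :
    ∀ᵐ ω ∂P, (∀ M : ℕ, ∀ᶠ n in atTop, M < (L (chain Φ Y s₀ n ω)).natAbs) ∧
      (∀ᶠ n in atTop, Y n ω ∉ B (chain Φ Y s₀ n ω)) ∧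
      ¬ Tendsto (fun n => ψ (L (chain Φ Y s₀ n ω))) atTop atTop := by
  have hLy := isLyapunov_ofReal (Φ := Φ) (ν := ν) (h := fun s => ψ (L s))
    (g := fun s => c * (ρ ^ (L s).natAbs)⁻¹) (fun s => hψ _) (fun s => by positivity) hi hd
  have hB' : ∀ s, ν (B s) ≤ C * ENNReal.ofReal c⁻¹ * ENNReal.ofReal (c * (ρ ^ (L s).natAbs)⁻¹) := by
    intro s
    rw [mul_assoc, ← ENNReal.ofReal_mul (by positivity), inv_mul_cancel_left₀ hc.ne']
    exact hBν s
  filter_upwards [hLy.ae_tendsto_zero (s₀ := s₀) hY hYm hΦ,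
    hLy.ae_eventually_notMem (s₀ := s₀) hY hYm hΦ hB (ENNReal.mul_ne_top hC ENNReal.ofReal_ne_top)
      hB', hLy.ae_not_tendsto_top (s₀ := s₀) hY hYm hΦ] with ω h1 h2 h3
  refine ⟨fun M => ?_, h2, fun h => h3 ?_⟩
  · have hpos : 0 < ENNReal.ofReal (c * (ρ ^ M)⁻¹) := ENNReal.ofReal_pos.2 (by positivity)
    filter_upwards [h1.eventually_lt_const hpos] with n hn
    by_contra hM
    refine absurd hn (not_lt.2 (ENNReal.ofReal_le_ofReal ?_))
    gcongr
    · exact hρ.le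
    · omega
  · exact ENNReal.tendsto_ofReal_atTop.comp h

end Escape

instance : MeasurableSingletonClass ℤˣ where
  measurableSet_singleton e := by
    have : ({e} : Set ℤˣ) = Units.val ⁻¹' {(e : ℤ)} := by
      ext z
      exact Units.ext_iff
    rw [this]
    exact ⟨_, measurableSet_singleton _, rfl⟩

/-! ### Draw probabilities as a logistic function of the colour difference. -/

/-- The probability of black for a difference `k` between the numbers of black and white balls. -/
noncomputable def logistic (ρ : ℝ) (k : ℤ) : ℝ := (1 + ρ ^ (-k))⁻¹

/-- The increment `±1` of the difference between the numbers of black and white balls, for a draw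
driven by `v` out of urns where this difference is `k`. -/
noncomputable def pull (ρ : ℝ) (k : ℤ) (v : I) : ℤ := if (v : ℝ) < logistic ρ k then 1 else -1

/-- The driving numbers for which the colour drawn is in the minority. -/
def minority (ρ : ℝ) (k : ℤ) : Set I := {v | pull ρ k v = if 0 ≤ k then -1 else 1}

section Logistic

variable {ρ : ℝ}

theorem logistic_pos (hρ : 1 < ρ) (k : ℤ) : 0 < logistic ρ k := by
  have : 0 < ρ := by linarith
  unfold logistic; positivity

theorem logistic_neg (hρ : 1 < ρ) (k : ℤ) : logistic ρ (-k) = 1 - logistic ρ k := by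
  have h0 : 0 < ρ := by linarith
  have h1 : 0 < ρ ^ k := by positivity
  unfold logistic
  rw [neg_neg, zpow_neg]
  field_simp
  ring

theorem logistic_lt_one (hρ : 1 < ρ) (k : ℤ) : logistic ρ k < 1 := by
  have := logistic_pos hρ (-k)
  rw [logistic_neg hρ] at this
  linarith

theorem half_le_logistic (hρ : 1 < ρ) {k : ℤ} (hk : 0 ≤ k) : 1 / 2 ≤ logistic ρ k := by
  have h0 : 0 < ρ := by linarith
  have h1 : ρ ^ (-k) ≤ 1 := zpow_le_one_of_nonpos₀ hρ.le (by omega)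
  have h2 : 0 < ρ ^ (-k) := by positivity
  unfold logistic
  rw [one_div]
  exact inv_anti₀ (by positivity) (by linarith)

theorem logistic_le_half (hρ : 1 < ρ) {k : ℤ} (hk : k ≤ 0) : logistic ρ k ≤ 1 / 2 := by
  have := half_le_logistic hρ (k := -k) (by omega)
  rw [logistic_neg hρ] at this
  linarith

theorem logistic_le_inv_pow (hρ : 1 < ρ) {k : ℤ} (hk : k ≤ 0) :
    logistic ρ k ≤ (ρ ^ k.natAbs)⁻¹ := by
  have h0 : 0 < ρ := by linarith
  unfold logistic
  refine inv_anti₀ (by positivity) ?_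
  rw [← zpow_natCast, show ((k.natAbs : ℕ) : ℤ) = -k by omega]
  linarith

theorem one_sub_logistic_le_inv_pow (hρ : 1 < ρ) {k : ℤ} (hk : 0 ≤ k) :
    1 - logistic ρ k ≤ (ρ ^ k.natAbs)⁻¹ := by
  rw [← logistic_neg hρ, ← Int.natAbs_neg]
  exact logistic_le_inv_pow hρ (by omega)

theorem exists_logistic_near (hρ : 1 < ρ) {η : ℝ} (hη : 0 < η) :
    ∃ K : ℕ, (∀ k : ℤ, K ≤ k → 1 - η ≤ logistic ρ k) ∧ ∀ k : ℤ, k ≤ -K → logistic ρ k ≤ η := by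
  obtain ⟨K, hK⟩ := exists_pow_lt_of_lt_one hη (inv_lt_one_of_one_lt₀ hρ)
  have h0 : 0 < ρ := by linarith
  have h1 : ∀ k : ℤ, K ≤ k.natAbs → (ρ ^ k.natAbs)⁻¹ ≤ η := fun k hk => by
    rw [inv_pow] at hK
    exact (inv_anti₀ (by positivity) (pow_le_pow_right₀ hρ.le hk)).trans hK.le
  refine ⟨K, fun k hk => ?_, fun k hk => ?_⟩
  · linarith [one_sub_logistic_le_inv_pow hρ (show 0 ≤ k by omega), h1 k (by omega)]
  · linarith [logistic_le_inv_pow hρ (show k ≤ 0 by omega), h1 k (by omega)]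

theorem measurable_pull (ρ : ℝ) (k : ℤ) : Measurable (pull ρ k) :=
  Measurable.ite (measurableSet_lt measurable_subtype_coe measurable_const) measurable_const
    measurable_const

theorem pull_eq_or (ρ : ℝ) (k : ℤ) (v : I) : pull ρ k v = 1 ∨ pull ρ k v = -1 := by
  unfold pull; split_ifs <;> simp

theorem abs_pull (ρ : ℝ) (k : ℤ) (v : I) : |pull ρ k v| = 1 := by
  rcases pull_eq_or ρ k v with h | h <;> simp [h]

theorem volume_lt_logistic (hρ : 1 < ρ) (k : ℤ) :
    volume {v : I | (v : ℝ) < logistic ρ k} = ENNReal.ofReal (logistic ρ k) :=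
  unitInterval.volume_Iio ⟨logistic ρ k, (logistic_pos hρ k).le, (logistic_lt_one hρ k).le⟩

theorem volume_logistic_le (hρ : 1 < ρ) (k : ℤ) :
    volume {v : I | ¬ (v : ℝ) < logistic ρ k} = ENNReal.ofReal (1 - logistic ρ k) := by
  have := unitInterval.volume_Ici ⟨logistic ρ k, (logistic_pos hρ k).le, (logistic_lt_one hρ k).le⟩
  rw [← this]
  congr 1
  ext v
  simp [← Subtype.coe_le_coe]

theorem integral_pull (hρ : 1 < ρ) (k : ℤ) :
    ∫ v, (pull ρ k v : ℝ) = 2 * logistic ρ k - 1 := by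
  have hs : MeasurableSet {v : I | (v : ℝ) < logistic ρ k} :=
    measurableSet_lt measurable_subtype_coe measurable_const
  have h1 : ∀ v, (pull ρ k v : ℝ) = 2 * {v : I | (v : ℝ) < logistic ρ k}.indicator 1 v - 1 := by
    intro v
    by_cases hv : (v : ℝ) < logistic ρ k
    · simp [pull, hv]; norm_num
    · simp [pull, hv]
  have hi : Integrable ({v : I | (v : ℝ) < logistic ρ k}.indicator (1 : I → ℝ)) volume :=
    (integrable_const _).indicator hs
  simp_rw [h1]
  rw [integral_sub (hi.const_mul 2) (integrable_const _), integral_const_mul,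
    integral_indicator_one hs, measureReal_def, volume_lt_logistic hρ,
    ENNReal.toReal_ofReal (logistic_pos hρ k).le]
  simp

theorem measurableSet_minority (ρ : ℝ) (k : ℤ) : MeasurableSet (minority ρ k) :=
  measurable_pull ρ k (measurableSet_singleton _)

theorem volume_minority_le (hρ : 1 < ρ) (k : ℤ) :
    volume (minority ρ k) ≤ ENNReal.ofReal (ρ ^ k.natAbs)⁻¹ := by
  by_cases hk : 0 ≤ k
  · have : minority ρ k = {v : I | ¬ (v : ℝ) < logistic ρ k} := by
      ext v
      simp [minority, pull, hk]
    rw [this, volume_logistic_le hρ]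
    exact ENNReal.ofReal_le_ofReal (one_sub_logistic_le_inv_pow hρ hk)
  · have : minority ρ k = {v : I | (v : ℝ) < logistic ρ k} := by
      ext v
      by_cases hv : (v : ℝ) < logistic ρ k <;> simp [minority, pull, hv, hk]
    rw [this, volume_lt_logistic hρ]
    exact ENNReal.ofReal_le_ofReal (logistic_le_inv_pow hρ (by omega))

theorem pull_of_notMem_minority {k : ℤ} {v : I} (h : v ∉ minority ρ k) :
    pull ρ k v = if 0 ≤ k then 1 else -1 := by
  simp only [minority, Set.mem_ofPred_eq] at h
  rcases pull_eq_or ρ k v with h' | h' <;> split_ifs with hk <;> simp_all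

theorem pull_eq_one (hρ : 1 < ρ) {k : ℤ} (hk : 0 ≤ k) {v : I} (hv : (v : ℝ) < 1 / 2) :
    pull ρ k v = 1 :=
  if_pos (hv.trans_le (half_le_logistic hρ hk))

theorem pull_eq_neg_one (hρ : 1 < ρ) {k : ℤ} (hk : k ≤ 0) {v : I} (hv : 1 / 2 < (v : ℝ)) :
    pull ρ k v = -1 :=
  if_neg (not_lt.2 ((logistic_le_half hρ hk).trans hv.le))

end Logistic

/-! ### The noise of one time step. -/

/-- The randomness used at one time: the types of the draws, and the driving numbers. -/
abbrev Noise (U : ℕ) : Type := (Fin U → ℤˣ) × (Fin U → I)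

/-- The law of the randomness used at one time. -/
noncomputable def noiseLaw (U : ℕ) (p : I) : Measure (Noise U) :=
  (Measure.pi fun _ => bernoulliMeasure (1 : ℤˣ) (-1) p).prod (Measure.pi fun _ => volume)

instance (U : ℕ) (p : I) : IsProbabilityMeasure (noiseLaw U p) := by
  unfold noiseLaw; infer_instance

section Noise

variable {U : ℕ} {p : I}

theorem measurePreserving_noise_eval (u : Fin U) :
    MeasurePreserving (fun y : Noise U => (y.1 u, y.2 u)) (noiseLaw U p)
      ((bernoulliMeasure (1 : ℤˣ) (-1) p).prod volume) :=
  (measurePreserving_eval (fun _ : Fin U => bernoulliMeasure (1 : ℤˣ) (-1) p) u).prod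
    (measurePreserving_eval (fun _ : Fin U => (volume : Measure I)) u)

theorem integral_noise_eval (u : Fin U) {F : ℤˣ → I → ℝ} (hF : ∀ e, Measurable (F e)) {C : ℝ}
    (hC : ∀ e v, |F e v| ≤ C) :
    ∫ y, F (y.1 u) (y.2 u) ∂noiseLaw U p = p * (∫ v, F 1 v) + (1 - p) * ∫ v, F (-1) v := by
  have hF' : Measurable fun q : ℤˣ × I => F q.1 q.2 :=
    measurable_from_prod_countable_right fun s => hF s
  have h := measurePreserving_noise_eval (p := p) u
  rw [← integral_map (f := fun q : ℤˣ × I => F q.1 q.2) h.measurable.aemeasurable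
    hF'.aestronglyMeasurable, h.map_eq, integral_prod _ (Integrable.of_bound
      hF'.aestronglyMeasurable C (ae_of_all _ fun q => hC _ _)), integral_bernoulliMeasure]
  simp

theorem noiseLaw_eval_minority_le {ρ : ℝ} (hρ : 1 < ρ) (k : ℤ) (u : Fin U) :
    noiseLaw U p {y | y.2 u ∈ minority ρ k} ≤ ENNReal.ofReal (ρ ^ k.natAbs)⁻¹ := by
  have h : MeasurePreserving (fun y : Noise U => y.2 u) (noiseLaw U p) volume :=
    measurePreserving_snd.comp (measurePreserving_noise_eval u)
  have := h.measure_preimage (measurableSet_minority ρ k).nullMeasurableSet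
  exact this.le.trans (volume_minority_le hρ k)

/-- Source of the uniform lower bounds `ε` on the probability of a step in a given direction: all
urns use the same draw type, with driving numbers in a common set. -/
theorem noiseLaw_box_pos (e : ℤˣ) {J : Set I} (he : bernoulliMeasure (1 : ℤˣ) (-1) p {e} ≠ 0)
    (hJ : volume J ≠ 0) :
    0 < (noiseLaw U p).real {y | ∀ u, y.1 u = e ∧ y.2 u ∈ J} := by
  have h : {y : Noise U | ∀ u, y.1 u = e ∧ y.2 u ∈ J}
      = (Set.univ.pi fun _ => {e}) ×ˢ (Set.univ.pi fun _ => J) := by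
    ext y
    simp [Set.mem_pi, forall_and]
  rw [measureReal_def, h, noiseLaw, Measure.prod_prod, Measure.pi_pi, Measure.pi_pi]
  refine ENNReal.toReal_pos (mul_ne_zero ?_ ?_) (ENNReal.mul_ne_top ?_ ?_)
  · exact Finset.prod_ne_zero_iff.2 fun _ _ => he
  · exact Finset.prod_ne_zero_iff.2 fun _ _ => hJ
  · exact ENNReal.prod_ne_top fun _ _ => measure_ne_top _ _
  · exact ENNReal.prod_ne_top fun _ _ => measure_ne_top _ _

theorem bernoulli_one_ne_zero (hp : 0 < (p : ℝ)) : bernoulliMeasure (1 : ℤˣ) (-1) p {1} ≠ 0 := by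
  rw [bernoulliMeasure_apply_of_mem_of_notMem p (measurableSet_singleton _) rfl (by decide)]
  refine ENNReal.coe_ne_zero.2 fun h => hp.ne' ?_
  simpa using congrArg NNReal.toReal h

theorem bernoulli_neg_one_ne_zero (hp : (p : ℝ) < 1) :
    bernoulliMeasure (1 : ℤˣ) (-1) p {-1} ≠ 0 := by
  rw [bernoulliMeasure_apply_of_notMem_of_mem p (measurableSet_singleton _) (by decide) rfl]
  refine ENNReal.coe_ne_zero.2 fun h => hp.ne' ?_
  have := congrArg NNReal.toReal h
  simp at this
  linarith

theorem volume_lt_half_ne_zero : volume {v : I | (v : ℝ) < 1 / 2} ≠ 0 := by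
  have h : {v : I | (v : ℝ) < 1 / 2} = Set.Iio ⟨1 / 2, by norm_num, by norm_num⟩ := rfl
  rw [h, unitInterval.volume_Iio]
  simp

theorem volume_half_lt_ne_zero : volume {v : I | 1 / 2 < (v : ℝ)} ≠ 0 := by
  have h : {v : I | 1 / 2 < (v : ℝ)} = Set.Ioi ⟨1 / 2, by norm_num, by norm_num⟩ := rfl
  rw [h, unitInterval.volume_Ioi]
  norm_num

end Noise

/-! ### Escape of single-urn differences and of the total with forced signs. -/

section UrnChains

variable {U : ℕ}

/-- One step of the differences between the numbers of black and white balls. -/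
noncomputable def diffStep (ρ : ℝ) (D : Fin U → ℤ) (y : Noise U) : Fin U → ℤ := fun u =>
  D u + pull ρ (if y.1 u = 1 then ∑ v, D v else D u) (y.2 u)

/-- The increment of the total difference `k` when the draws out of single urns are forced to have
the signs `s`. -/
noncomputable def forcedIncrement (ρ : ℝ) (s : Fin U → ℤˣ) (k : ℤ) (y : Noise U) : ℤ :=
  ∑ u, if y.1 u = 1 then pull ρ k (y.2 u) else (s u : ℤ)

theorem measurable_noise_eval {β : Type*} [MeasurableSpace β] {F : ℤˣ → I → β}
    (hF : ∀ e, Measurable (F e)) (u : Fin U) : Measurable fun y : Noise U => F (y.1 u) (y.2 u) := by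
  have hF' : Measurable fun q : ℤˣ × I => F q.1 q.2 :=
    measurable_from_prod_countable_right fun s => hF s
  have h : Measurable fun y : Noise U => (y.1 u, y.2 u) := by fun_prop
  exact hF'.comp h

theorem measurable_diffStep (ρ : ℝ) (D : Fin U → ℤ) : Measurable (diffStep ρ D) :=
  measurable_pi_lambda _ fun u => measurable_const.add
    (measurable_noise_eval (F := fun e => pull ρ (if e = 1 then ∑ v, D v else D u))
      (fun _ => measurable_pull ρ _) u)

theorem measurable_forcedIncrement (ρ : ℝ) (s : Fin U → ℤˣ) (k : ℤ) :
    Measurable (forcedIncrement ρ s k) :=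
  Finset.measurable_sum _ fun u _ =>
    measurable_noise_eval (F := fun e v => if e = 1 then pull ρ k v else (s u : ℤ))
      (fun e => by split_ifs; exacts [measurable_pull ρ k, measurable_const]) u

theorem abs_units_int (e : ℤˣ) : |(e : ℤ)| = 1 := by
  rcases Int.units_eq_one_or e with h | h <;> simp [h]

theorem abs_forcedIncrement_le (ρ : ℝ) (s : Fin U → ℤˣ) (k : ℤ) (y : Noise U) :
    |forcedIncrement ρ s k y| ≤ U := by
  refine (Finset.abs_sum_le_sum_abs _ _).trans ?_
  refine (Finset.sum_le_sum (g := fun _ => 1) fun u _ => ?_).trans (by simp)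
  split_ifs
  · exact (abs_pull _ _ _).le
  · exact (abs_units_int _).le

variable {ρ : ℝ} {p : I}

theorem integral_pull_noise (hρ : 1 < ρ) (u : Fin U) (k l : ℤ) :
    ∫ y, (pull ρ (if y.1 u = 1 then k else l) (y.2 u) : ℝ) ∂noiseLaw U p
      = p * (2 * logistic ρ k - 1) + (1 - p) * (2 * logistic ρ l - 1) := by
  have := integral_noise_eval (p := p) u
    (F := fun e v => (pull ρ (if e = 1 then k else l) v : ℝ)) (C := 1)
    (fun e => (measurable_of_countable (Int.cast : ℤ → ℝ)).comp (measurable_pull ρ _))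
    (fun e v => by exact_mod_cast (abs_pull ρ _ v).le)
  rw [this]
  have h : ¬ ((-1 : ℤˣ) = 1) := by decide
  simp only [if_true, h, if_false, integral_pull hρ]

theorem integral_forcedIncrement (hρ : 1 < ρ) (s : Fin U → ℤˣ) (k : ℤ) :
    ∫ y, (forcedIncrement ρ s k y : ℝ) ∂noiseLaw U p
      = p * U * (2 * logistic ρ k - 1) + (1 - p) * ∑ u, ((s u : ℤ) : ℝ) := by
  have hm : ∀ u e, Measurable fun v => ((if e = (1 : ℤˣ) then pull ρ k v else (s u : ℤ) : ℤ) : ℝ) :=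
    fun u e => (measurable_of_countable (Int.cast : ℤ → ℝ)).comp (by
      split_ifs
      exacts [measurable_pull ρ k, measurable_const])
  have hb : ∀ u e v, |((if e = (1 : ℤˣ) then pull ρ k v else (s u : ℤ) : ℤ) : ℝ)| ≤ 1 := by
    intro u e v
    split_ifs
    · exact_mod_cast (abs_pull ρ k v).le
    · exact_mod_cast (abs_units_int (s u)).le
  have h : ¬ ((-1 : ℤˣ) = 1) := by decide
  unfold forcedIncrement
  push_cast
  rw [integral_finsetSum]
  · have : ∀ u, ∫ y, ((if y.1 u = (1 : ℤˣ) then pull ρ k (y.2 u) else (s u : ℤ) : ℤ) : ℝ)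
        ∂noiseLaw U p = p * (2 * logistic ρ k - 1) + (1 - p) * ((s u : ℤ) : ℝ) := by
      intro u
      rw [integral_noise_eval u (F := fun e v => ((if e = (1 : ℤˣ) then pull ρ k v else
        (s u : ℤ) : ℤ) : ℝ)) (hm u) (hb u)]
      simp only [if_true, h, if_false, integral_pull hρ]
      simp
    push_cast at this
    simp_rw [this]
    rw [Finset.sum_add_distrib, ← Finset.mul_sum, ← Finset.mul_sum]
    simp
    ring
  · intro u _
    have := Integrable.of_bound (μ := noiseLaw U p)
      (measurable_noise_eval (hm u) u).aestronglyMeasurable 1 (ae_of_all _ fun y => hb u _ _)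
    simpa using this

variable {Ω : Type*} [MeasurableSpace Ω] {P : Measure Ω} [IsProbabilityMeasure P]
  {Y : ℕ → Ω → Noise U}

/-- In each urn the difference between the colours tends to infinity, and the draws driven by the
composition of this urn alone eventually give the majority colour. -/
theorem ae_diff_escape (hρ : 1 < ρ) (hp : (p : ℝ) < 1 / 2) (hY : iIndepFun Y P)
    (hYm : ∀ n, MeasurePreserving (Y n) P (noiseLaw U p)) (D₀ : Fin U → ℤ) (u : Fin U) :
    ∀ᵐ ω ∂P, (∀ M : ℕ, ∀ᶠ n in atTop, M < (chain (diffStep ρ) Y D₀ n ω u).natAbs) ∧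
      ∀ᶠ n in atTop, (Y n ω).2 u ∉ minority ρ (chain (diffStep ρ) Y D₀ n ω u) := by
  have hp0 : (0 : ℝ) ≤ p := p.2.1
  -- Beyond `K`, even if combined draws all pull inwards, the outward drift is at least `(1 - p) *
  -- (1 - 2 * η) - p ≥ (1 - 2 * p) / 2`.
  obtain ⟨K, hK1, hK2⟩ := exists_logistic_near hρ (η := (1 - 2 * p) / 4) (by linarith)
  have he := bernoulli_neg_one_ne_zero (p := p) (by linarith)
  obtain ⟨ε, hε0, hε⟩ : ∃ ε : ℝ, 0 < ε ∧ ε ≤ min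
      ((noiseLaw U p).real {y | ∀ u, y.1 u = -1 ∧ y.2 u ∈ {v : I | (v : ℝ) < 1 / 2}})
      ((noiseLaw U p).real {y | ∀ u, y.1 u = -1 ∧ y.2 u ∈ {v : I | 1 / 2 < (v : ℝ)}}) :=
    ⟨_, lt_min (noiseLaw_box_pos _ he volume_lt_half_ne_zero)
      (noiseLaw_box_pos _ he volume_half_lt_ne_zero), le_rfl⟩
  obtain ⟨hε1, hε2⟩ := le_min_iff.1 hε
  obtain ⟨ψ, c, hc, hψ, hstep⟩ := exists_twoSided_step (Noise U) (U := 1) le_rfl hρ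
    (a := (1 - 2 * p) / 2) (by linarith) hε0 K
  have hneg : ¬ ((-1 : ℤˣ) = 1) := by decide
  have hξm : ∀ D : Fin U → ℤ, Measurable fun y : Noise U =>
      pull ρ (if y.1 u = 1 then ∑ v, D v else D u) (y.2 u) := fun D =>
    measurable_noise_eval (F := fun e => pull ρ (if e = 1 then ∑ v, D v else D u))
      (fun _ => measurable_pull ρ _) u
  have hξb : ∀ (D : Fin U → ℤ) (y : Noise U),
      |pull ρ (if y.1 u = 1 then ∑ v, D v else D u) (y.2 u)| ≤ (1 : ℕ) := fun D y => by
    simpa using (abs_pull ρ _ _).le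
  have key := ae_escape (Φ := diffStep ρ) (L := fun D => D u) (ψ := ψ) (s₀ := D₀)
    (B := fun D => {y | y.2 u ∈ minority ρ (D u)}) (C := 1) hY hYm (measurable_diffStep ρ) hρ hc hψ
    (fun D => integrable_comp_of_bdd (hξm D) (hξb D) fun j => ψ (D u + j))
    (fun D => ?_) (fun D => ?_) ENNReal.one_ne_top (fun D => ?_)
  · filter_upwards [key] with ω hω
    exact ⟨hω.1, hω.2.1⟩
  · refine hstep (noiseLaw U p) _ (D u) (hξm D) (hξb D) ?_ ?_ ?_ ?_
    · intro _ hk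
      rw [integral_pull_noise hρ]
      have h1 := hK1 _ hk
      have h2 := logistic_pos hρ (∑ v, D v)
      nlinarith
    · intro hk _
      refine hε1.trans (measureReal_mono fun y hy => ?_)
      simp only [Set.mem_ofPred_eq, (hy u).1, hneg, if_false, pull_eq_one hρ hk (hy u).2, le_refl]
    · intro _ hk
      rw [integral_pull_noise hρ]
      have h1 := hK2 _ hk
      have h2 := logistic_lt_one hρ (∑ v, D v)
      nlinarith
    · intro hk _
      refine hε2.trans (measureReal_mono fun y hy => ?_)
      simp only [Set.mem_ofPred_eq, (hy u).1, hneg, if_false, pull_eq_neg_one hρ hk (hy u).2,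
        le_refl]
  · exact ((measurable_pi_apply u).comp measurable_snd) (measurableSet_minority ρ _)
  · rw [one_mul]
    exact noiseLaw_eval_minority_le hρ (D u) u

/-- The long-time behaviour of the total difference, when the draws out of single urns are forced
to have the signs `s`. -/
theorem ae_forced_escape (hU : 1 ≤ U) (hρ : 1 < ρ) (hp₀ : 0 < (p : ℝ)) (hp : (p : ℝ) < 1 / 2)
    (hY : iIndepFun Y P) (hYm : ∀ n, MeasurePreserving (Y n) P (noiseLaw U p))
    (s : Fin U → ℤˣ) (m : ℤ) :
    ∀ᵐ ω ∂P, (∀ M : ℕ, ∀ᶠ n in atTop,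
        M < (chain (fun k y => k + forcedIncrement ρ s k y) Y m n ω).natAbs) ∧
      (∀ᶠ n in atTop, ∀ u, (Y n ω).2 u ∉
        minority ρ (chain (fun k y => k + forcedIncrement ρ s k y) Y m n ω)) ∧
      ((1 - p) * ∑ u, ((s u : ℤ) : ℝ) + p * U ≤ 0 → ¬ Tendsto (fun n =>
        chain (fun k y => k + forcedIncrement ρ s k y) Y m n ω) atTop atTop) ∧
      (0 ≤ (1 - p) * ∑ u, ((s u : ℤ) : ℝ) - p * U → ¬ Tendsto (fun n =>
        chain (fun k y => k + forcedIncrement ρ s k y) Y m n ω) atTop atBot) := by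
  have hU0 : (0 : ℝ) < U := by exact_mod_cast hU
  have hpU : 0 < p * (U : ℝ) := by positivity
  have hneg : ¬ ((-1 : ℤˣ) = 1) := by decide
  set τ : ℝ := ∑ u, ((s u : ℤ) : ℝ) with hτ
  have hτZ : τ = ((∑ u, (s u : ℤ) : ℤ) : ℝ) := by push_cast; rfl
  have hΦ : ∀ k, Measurable fun y : Noise U => k + forcedIncrement ρ s k y := fun k =>
    measurable_const.add (measurable_forcedIncrement ρ s k)
  have hBm : ∀ k, MeasurableSet {y : Noise U | ∃ u, y.2 u ∈ minority ρ k} := by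
    intro k
    simp only [Set.ofPred_exists]
    exact MeasurableSet.iUnion fun u =>
      ((measurable_pi_apply u).comp measurable_snd) (measurableSet_minority ρ _)
  have hBν : ∀ k, noiseLaw U p {y : Noise U | ∃ u, y.2 u ∈ minority ρ k}
      ≤ U * ENNReal.ofReal (ρ ^ k.natAbs)⁻¹ := by
    intro k
    simp only [Set.ofPred_exists]
    refine (measure_iUnion_fintype_le _ _).trans
      ((Finset.sum_le_sum fun u _ => noiseLaw_eval_minority_le hρ k u).trans ?_)
    simp
  have hall : ∀ y : Noise U, (∀ u, y.1 u = -1 ∧ y.2 u ∈ Set.univ) → ∀ k,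
      forcedIncrement ρ s k y = ∑ u, (s u : ℤ) := by
    intro y hy k
    refine Finset.sum_congr rfl fun u _ => ?_
    rw [(hy u).1, if_neg hneg]
  have hbox := noiseLaw_box_pos (U := U) (p := p) (-1) (J := Set.univ)
    (bernoulli_neg_one_ne_zero (by linarith)) (by simp)
  -- Drift at `+∞` not positive, possibly zero: at every finite `k > 0` the mean is still
  -- nonpositive, and for `k ≤ 0` it is at most `-p * U`. All urns drawing alone gives the increment
  -- `τ ≤ -1` with positive probability.
  rcases le_or_gt ((1 - p) * τ + p * U) 0 with hcase | hcase
  · have hτ0 : ∑ u, (s u : ℤ) ≤ -1 := by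
      have : τ < 0 := by
        by_contra h
        push Not at h
        nlinarith
      rw [hτZ] at this
      have : ∑ u, (s u : ℤ) < 0 := by exact_mod_cast this
      omega
    obtain ⟨ψ, c, hc, hψ, hψ', hstep⟩ := exists_oneSided_step (Noise U) hU hρ hpU hbox
    have key := ae_escape (Φ := fun k y => k + forcedIncrement ρ s k y) (L := id) (ψ := ψ) (s₀ := m)
      (B := fun k => {y | ∃ u, y.2 u ∈ minority ρ k}) (C := U) hY hYm hΦ hρ hc hψ
      (fun k => integrable_comp_of_bdd (measurable_forcedIncrement ρ s k)
        (abs_forcedIncrement_le ρ s k) fun j => ψ (k + j))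
      (fun k => ?_) hBm (ENNReal.natCast_ne_top _) hBν
    · filter_upwards [key] with ω hω
      refine ⟨hω.1, ?_, fun _ h => hω.2.2 ?_, fun h => absurd h (by linarith)⟩
      · filter_upwards [hω.2.1] with n hn u hu using hn ⟨u, hu⟩
      · exact tendsto_atTop_mono (fun n => hψ' _) (tendsto_intCast_atTop_atTop.comp h)
    · refine hstep (noiseLaw U p) _ k (measurable_forcedIncrement ρ s k)
        (abs_forcedIncrement_le ρ s k) ?_ ?_
      · intro hk
        rw [integral_forcedIncrement hρ]
        have := logistic_le_half hρ hk
        nlinarith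
      · intro hk
        refine ⟨?_, measureReal_mono fun y hy => ?_⟩
        · rw [integral_forcedIncrement hρ]
          have := logistic_lt_one hρ k
          nlinarith
        · simpa only [Set.mem_ofPred_eq, hall y hy k] using hτ0
  -- The mirror image, treated through `-k`.
  rcases le_or_gt 0 ((1 - p) * τ - p * U) with hcase' | hcase'
  · have hτ0 : 1 ≤ ∑ u, (s u : ℤ) := by
      have : 0 < τ := by
        by_contra h
        push Not at h
        nlinarith
      rw [hτZ] at this
      have : 0 < ∑ u, (s u : ℤ) := by exact_mod_cast this
      omega
    obtain ⟨ψ, c, hc, hψ, hψ', hstep⟩ := exists_oneSided_step (Noise U) hU hρ hpU hbox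
    have hnm : ∀ k, Measurable fun y : Noise U => -forcedIncrement ρ s k y := fun k =>
      (measurable_forcedIncrement ρ s k).neg
    have hnb : ∀ k (y : Noise U), |-forcedIncrement ρ s k y| ≤ U := fun k y => by
      rw [abs_neg]
      exact abs_forcedIncrement_le ρ s k y
    have hmean : ∀ k, ∫ y, ((-forcedIncrement ρ s k y : ℤ) : ℝ) ∂noiseLaw U p
        = -(p * U * (2 * logistic ρ k - 1) + (1 - p) * τ) := fun k => by
      push_cast
      rw [integral_neg, integral_forcedIncrement hρ]
    have key := ae_escape (Φ := fun k y => k + forcedIncrement ρ s k y) (L := fun k => -k) (ψ := ψ)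
      (s₀ := m)
      (B := fun k => {y | ∃ u, y.2 u ∈ minority ρ k}) (C := U) hY hYm hΦ hρ hc hψ
      (fun k => by
        simp only [neg_add]
        exact integrable_comp_of_bdd (hnm k) (hnb k) fun j => ψ (-k + j))
      (fun k => ?_) hBm (ENNReal.natCast_ne_top _) (fun k => by
        rw [Int.natAbs_neg]
        exact hBν k)
    · filter_upwards [key] with ω hω
      refine ⟨?_, ?_, fun h => absurd h (by linarith), fun _ h => hω.2.2 ?_⟩
      · simpa only [Int.natAbs_neg] using hω.1
      · filter_upwards [hω.2.1] with n hn u hu using hn ⟨u, hu⟩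
      · exact tendsto_atTop_mono (fun n => hψ' _)
          (tendsto_intCast_atTop_atTop.comp (tendsto_neg_atBot_atTop.comp h))
    · simp only [neg_add]
      refine hstep (noiseLaw U p) _ (-k) (hnm k) (hnb k) ?_ ?_
      · intro hk
        rw [hmean]
        have := half_le_logistic hρ (show 0 ≤ k by omega)
        nlinarith
      · intro hk
        refine ⟨?_, measureReal_mono fun y hy => ?_⟩
        · rw [hmean]
          have := logistic_pos hρ k
          nlinarith
        · simp only [Set.mem_ofPred_eq, hall y hy k]
          omega
  · have he := bernoulli_one_ne_zero hp₀
    obtain ⟨b, hb0, hb1, hb2⟩ : ∃ b : ℝ, 0 < b ∧ b ≤ (1 - p) * τ + p * U ∧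
        b ≤ p * U - (1 - p) * τ :=
      ⟨min ((1 - p) * τ + p * U) (p * U - (1 - p) * τ), lt_min hcase (by linarith),
        min_le_left _ _, min_le_right _ _⟩
    -- Both limiting drifts point outwards with size at least `b`; this `η` leaves `b / 2` of it
    -- beyond `K`. Near the origin, outward steps come from all urns making combined draws of the
    -- majority colour.
    obtain ⟨η, hη0, hη⟩ : ∃ η : ℝ, 0 < η ∧ (p : ℝ) * U * (2 * η) = b / 2 :=
      ⟨b / (4 * ((p : ℝ) * U)), by positivity, by field_simp; norm_num⟩
    obtain ⟨K, hK1, hK2⟩ := exists_logistic_near hρ hη0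
    obtain ⟨ε, hε0, hε⟩ : ∃ ε : ℝ, 0 < ε ∧ ε ≤ min
        ((noiseLaw U p).real {y | ∀ u, y.1 u = 1 ∧ y.2 u ∈ {v : I | (v : ℝ) < 1 / 2}})
        ((noiseLaw U p).real {y | ∀ u, y.1 u = 1 ∧ y.2 u ∈ {v : I | 1 / 2 < (v : ℝ)}}) :=
      ⟨_, lt_min (noiseLaw_box_pos _ he volume_lt_half_ne_zero)
        (noiseLaw_box_pos _ he volume_half_lt_ne_zero), le_rfl⟩
    obtain ⟨hε1, hε2⟩ := le_min_iff.1 hε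
    obtain ⟨ψ, c, hc, hψ, hstep⟩ := exists_twoSided_step (Noise U) hU hρ (half_pos hb0) hε0 K
    have key := ae_escape (Φ := fun k y => k + forcedIncrement ρ s k y) (L := id) (ψ := ψ) (s₀ := m)
      (B := fun k => {y | ∃ u, y.2 u ∈ minority ρ k}) (C := U) hY hYm hΦ hρ hc hψ
      (fun k => integrable_comp_of_bdd (measurable_forcedIncrement ρ s k)
        (abs_forcedIncrement_le ρ s k) fun j => ψ (k + j))
      (fun k => ?_) hBm (ENNReal.natCast_ne_top _) hBν
    · filter_upwards [key] with ω hω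
      refine ⟨hω.1, ?_, fun h => absurd h (by linarith), fun h => absurd h (by linarith)⟩
      filter_upwards [hω.2.1] with n hn u hu using hn ⟨u, hu⟩
    · refine hstep (noiseLaw U p) _ k (measurable_forcedIncrement ρ s k)
        (abs_forcedIncrement_le ρ s k) ?_ ?_ ?_ ?_
      · intro _ hk
        rw [integral_forcedIncrement hρ]
        have := mul_le_mul_of_nonneg_left (hK1 k hk) hpU.le
        nlinarith
      · intro hk _
        refine hε1.trans (measureReal_mono fun y hy => ?_)
        have : forcedIncrement ρ s k y = ∑ _u : Fin U, 1 :=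
          Finset.sum_congr rfl fun u _ => by rw [(hy u).1, if_pos rfl, pull_eq_one hρ hk (hy u).2]
        simp only [Set.mem_ofPred_eq, this]
        simpa using hU
      · intro _ hk
        rw [integral_forcedIncrement hρ]
        have := mul_le_mul_of_nonneg_left (hK2 k hk) hpU.le
        nlinarith
      · intro hk _
        refine hε2.trans (measureReal_mono fun y hy => ?_)
        have : forcedIncrement ρ s k y = ∑ _u : Fin U, -1 :=
          Finset.sum_congr rfl fun u _ => by
            rw [(hy u).1, if_pos rfl, pull_eq_neg_one hρ hk (hy u).2]
        simp only [Set.mem_ofPred_eq, this]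
        simpa using hU

end UrnChains

/-! ### Rows of an i.i.d. array are i.i.d. -/

section Rows

variable {X : Type*} [MeasurableSpace X] (μ : Measure X) [IsProbabilityMeasure μ] (U : ℕ)

theorem measurePreserving_curry_infinitePi :
    MeasurePreserving (fun (x : ℕ × Fin U → X) n u => x (n, u)) (Measure.infinitePi fun _ => μ)
      (Measure.infinitePi fun _ => Measure.infinitePi fun _ => μ) :=
  ⟨by fun_prop, Measure.infinitePi_map_curry fun (_ : ℕ) (_ : Fin U) => μ⟩

theorem measurePreserving_row (n : ℕ) :
    MeasurePreserving (fun (x : ℕ × Fin U → X) u => x (n, u)) (Measure.infinitePi fun _ => μ)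
      (Measure.pi fun _ => μ) := by
  rw [← Measure.infinitePi_eq_pi]
  exact (measurePreserving_eval_infinitePi (fun _ => Measure.infinitePi fun _ => μ) n).comp
    (measurePreserving_curry_infinitePi μ U)

theorem iIndepFun_row :
    iIndepFun (fun n (x : ℕ × Fin U → X) u => x (n, u)) (Measure.infinitePi fun _ => μ) := by
  rw [iIndepFun_iff_map_fun_eq_infinitePi_map (by fun_prop)]
  simp_rw [(measurePreserving_row μ U _).map_eq, ← Measure.infinitePi_eq_pi]
  exact (measurePreserving_curry_infinitePi μ U).map_eq

end Rows

/-! ### The joint law of environment and driving numbers. -/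

section Annealed

variable {U : ℕ} {p : I}

instance : IsProbabilityMeasure (environmentLaw U p) := by
  unfold environmentLaw; infer_instance

/-- The joint law of the environment and the driving numbers. -/
noncomputable def annealedLaw (U : ℕ) (p : I) : Measure (Environment U × (ℕ × Fin U → I)) :=
  (environmentLaw U p).prod (Measure.infinitePi fun _ => volume)

instance : IsProbabilityMeasure (annealedLaw U p) := by
  unfold annealedLaw; infer_instance

/-- The randomness used at time `n`. -/
def noise (n : ℕ) (ω : Environment U × (ℕ × Fin U → I)) : Noise U :=
  (fun u => ω.1 (n, u), fun u => ω.2 (n, u))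

theorem measurePreserving_noise (n : ℕ) :
    MeasurePreserving (noise n) (annealedLaw U p) (noiseLaw U p) :=
  (measurePreserving_row (bernoulliMeasure (1 : ℤˣ) (-1) p) U n).prod
    (measurePreserving_row (volume : Measure I) U n)

theorem iIndepFun_noise : iIndepFun (noise (U := U)) (annealedLaw U p) :=
  iIndepFun_prodMk_prod (iIndepFun_row (bernoulliMeasure (1 : ℤˣ) (-1) p) U)
    (iIndepFun_row (volume : Measure I) U) (by fun_prop) (by fun_prop)

/-- A run of `k` solo draws has probability `(1 - p) ^ k`, so an infinite run is null. -/
theorem ae_frequently_combined (hp₀ : 0 < (p : ℝ)) (u : Fin U) :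
    ∀ᵐ x ∂environmentLaw U p, ∃ᶠ n in atTop, x (n, u) = 1 := by
  have hq : bernoulliMeasure (1 : ℤˣ) (-1) p {-1} < 1 := by
    rw [bernoulliMeasure_apply_of_notMem_of_mem p (measurableSet_singleton _) (by decide) rfl,
      ENNReal.coe_lt_one_iff, ← NNReal.coe_lt_coe]
    simpa using hp₀
  have h0 : ∀ m, environmentLaw U p {x | ∀ n, m ≤ n → x (n, u) = -1} = 0 := by
    intro m
    refine le_antisymm (ge_of_tendsto' (ENNReal.tendsto_pow_atTop_nhds_zero_of_lt_one hq)
      fun k => ?_) zero_le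
    have hinj : Function.Injective fun i : ℕ => (m + i, u) := fun i j h => by simpa using h
    calc environmentLaw U p {x | ∀ n, m ≤ n → x (n, u) = -1}
        ≤ environmentLaw U p (Set.pi (((Finset.range k).map ⟨_, hinj⟩ : Finset (ℕ × Fin U)) :
            Set (ℕ × Fin U)) fun _ => {-1}) := by
          refine measure_mono fun x hx => ?_
          intro i hi
          simp only [Finset.coe_map, Set.mem_image, Function.Embedding.coeFn_mk] at hi
          obtain ⟨j, _, rfl⟩ := hi
          exact hx _ (Nat.le_add_right _ _)
      _ = _ := by
          rw [environmentLaw, Measure.infinitePi_pi _ fun _ _ => measurableSet_singleton _]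
          simp
  have h1 : ∀ᵐ x ∂environmentLaw U p, ∀ m, ¬ ∀ n, m ≤ n → x (n, u) = -1 :=
    ae_all_iff.2 fun m => measure_eq_zero_iff_ae_notMem.1 (h0 m)
  filter_upwards [h1] with x hx
  refine frequently_atTop.2 fun m => ?_
  obtain ⟨n, hn⟩ := not_forall.1 (hx m)
  obtain ⟨hmn, hn⟩ := Classical.not_imp.1 hn
  exact ⟨n, hmn, (Int.units_eq_one_or _).resolve_right hn⟩

end Annealed

/-! ### From the urn process to the chain of differences. -/

section UrnDynamics

variable {U : ℕ} {ρ : ℝ}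

theorem process_le (w : ℕ → ℝ) (x : Environment U) (V : ℕ × Fin U → I) (n : ℕ) (u : Fin U) :
    process w x V n u ≤ n := by
  induction n with
  | zero => exact le_rfl
  | succ n ih =>
    simp only [process]
    split_ifs <;> omega

theorem drawProb_pow (hρ : 1 < ρ) (i j : ℕ) :
    drawProb (fun i => ρ ^ i) i j = logistic ρ ((i : ℤ) - j) := by
  have h0 : 0 < ρ := by linarith
  have h1 : 0 < ρ ^ i := by positivity
  have h2 : 0 < ρ ^ j := by positivity
  rw [drawProb, logistic, neg_sub, zpow_sub₀ h0.ne', zpow_natCast, zpow_natCast]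
  field_simp

theorem blackProb_pow (hρ : 1 < ρ) (e : ℤˣ) (n : ℕ) (b : Fin U → ℕ) (hb : ∀ u, b u ≤ n)
    (u : Fin U) :
    blackProb (fun i => ρ ^ i) e n b u
      = logistic ρ (if e = 1 then ∑ v, (2 * (b v : ℤ) - n) else 2 * (b u : ℤ) - n) := by
  unfold blackProb
  split_ifs
  · rw [drawProb_pow hρ]
    congr 1
    push_cast
    rw [← Finset.sum_sub_distrib]
    refine Finset.sum_congr rfl fun v _ => ?_
    have := hb v
    push_cast [this]
    ring
  · rw [drawProb_pow hρ]
    congr 1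
    have := hb u
    push_cast [this]
    ring

theorem process_succ_eq (hρ : 1 < ρ) (x : Environment U) (V : ℕ × Fin U → I) (n : ℕ) (u : Fin U) :
    process (fun i => ρ ^ i) x V (n + 1) u = process (fun i => ρ ^ i) x V n u +
      if pull ρ (if x (n, u) = 1 then ∑ v, (2 * (process (fun i => ρ ^ i) x V n v : ℤ) - n)
        else 2 * (process (fun i => ρ ^ i) x V n u : ℤ) - n) (V (n, u)) = 1 then 1 else 0 := by
  simp only [process]
  rw [blackProb_pow hρ _ _ _ (process_le _ x V n)]
  congr 1
  unfold pull
  split_ifs <;> simp_all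

theorem chain_diffStep_eq (hρ : 1 < ρ) (x : Environment U) (V : ℕ × Fin U → I) (n : ℕ) :
    chain (diffStep ρ) noise 0 n (x, V) = fun u =>
      2 * (process (fun i => ρ ^ i) x V n u : ℤ) - n := by
  induction n with
  | zero => ext u; simp [chain, process]
  | succ n ih =>
    ext u
    rw [chain_succ, ih, process_succ_eq hρ]
    simp only [diffStep, noise]
    rcases pull_eq_or ρ (if x (n, u) = 1 then ∑ v, (2 * (process (fun i => ρ ^ i) x V n v : ℤ) - n)
        else 2 * (process (fun i => ρ ^ i) x V n u : ℤ) - n) (V (n, u)) with h | h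
    · rw [h, if_pos rfl]
      push_cast
      ring
    · rw [h, if_neg (by decide)]
      push_cast
      ring

/-- The sign of a colour. -/
def Colour.sign : Colour → ℤ
  | .black => 1
  | .white => -1

theorem colour_eq_iff (hρ : 1 < ρ) (x : Environment U) (V : ℕ × Fin U → I) (n : ℕ) (u : Fin U)
    (d : Colour) :
    colour ⟨process (fun i => ρ ^ i) x V, isUrnPath_process _ x V⟩ n u = d ↔
      pull ρ (if x (n, u) = 1 then ∑ v, chain (diffStep ρ) noise 0 n (x, V) v
        else chain (diffStep ρ) noise 0 n (x, V) u) (V (n, u)) = d.sign := by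
  rw [chain_diffStep_eq hρ]
  simp only [colour, process_succ_eq hρ]
  rcases pull_eq_or ρ (if x (n, u) = 1 then ∑ v, (2 * (process (fun i => ρ ^ i) x V n v : ℤ) - n)
        else 2 * (process (fun i => ρ ^ i) x V n u : ℤ) - n) (V (n, u)) with h | h <;>
  · rw [h]
    cases d <;> simp [Colour.sign]

theorem measurable_process (w : ℕ → ℝ) (x : Environment U) (n : ℕ) :
    Measurable fun V : ℕ × Fin U → I => process w x V n := by
  induction n with
  | zero => exact measurable_const
  | succ n ih =>
    refine measurable_pi_lambda _ fun u => ?_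
    refine ((measurable_pi_apply u).comp ih).add (Measurable.ite ?_ measurable_const
      measurable_const)
    exact measurableSet_lt (measurable_subtype_coe.comp (measurable_pi_apply _))
      ((measurable_of_countable fun b => blackProb w (x (n, u)) n b u).comp ih)

theorem measurable_urnPath (w : ℕ → ℝ) (x : Environment U) :
    Measurable fun V : ℕ × Fin U → I => (⟨process w x V, isUrnPath_process w x V⟩ : UrnPath U) :=
  Measurable.subtype_mk (measurable_pi_lambda _ fun n => measurable_process w x n)

/-- No measurability of `s` is needed: the image measure of any set is at least the measure of its
preimage. -/
theorem IUM_eq_one_of_ae {w : ℕ → ℝ} {x : Environment U} {s : Set (UrnPath U)}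
    (h : ∀ᵐ V ∂Measure.infinitePi fun _ : ℕ × Fin U => (volume : Measure I),
      (⟨process w x V, isUrnPath_process w x V⟩ : UrnPath U) ∈ s) :
    IUM w x s = 1 := by
  have hm := measurable_urnPath w x
  have : IsProbabilityMeasure (IUM w x) := Measure.isProbabilityMeasure_map hm.aemeasurable
  refine le_antisymm prob_le_one ?_
  refine le_trans (le_of_eq ?_) (Measure.le_map_apply hm.aemeasurable s)
  exact (prob_compl_eq_zero_iff₀ (NullMeasurableSet.of_compl
    (NullMeasurableSet.of_null (mem_ae_iff.1 h)))).1 (mem_ae_iff.1 h) |>.symm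

end UrnDynamics

/-! ### Pathwise consequences: suitability and the Conformism Equation. -/

section Paths

/-- Steps of size at most `B` cannot change the sign of a path staying outside `[-B, B]`. -/
theorem tendsto_atTop_of_escape {L : ℕ → ℤ} {B N : ℕ} (hL : ∀ n, |L (n + 1) - L n| ≤ B)
    (hN : ∀ n, N ≤ n → B < (L n).natAbs) (h0 : 0 ≤ L N)
    (h : ∀ M : ℕ, ∀ᶠ n in atTop, M < (L n).natAbs) : Tendsto L atTop atTop := by
  have hpos : ∀ n, N ≤ n → 0 ≤ L n := by
    intro n hn
    induction n, hn using Nat.le_induction with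
    | base => exact h0
    | succ n hn ih =>
      have := hN n hn
      have := abs_le.1 (hL n)
      omega
  refine tendsto_atTop.2 fun b => ?_
  filter_upwards [h b.natAbs, eventually_ge_atTop N] with n hn hNn
  have := hpos n hNn
  omega

theorem tendsto_atTop_or_atBot_of_escape {L : ℕ → ℤ} {B : ℕ} (hL : ∀ n, |L (n + 1) - L n| ≤ B)
    (h : ∀ M : ℕ, ∀ᶠ n in atTop, M < (L n).natAbs) :
    Tendsto L atTop atTop ∨ Tendsto L atTop atBot := by
  obtain ⟨N, hN⟩ := eventually_atTop.1 (h B)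
  rcases le_total 0 (L N) with h0 | h0
  · exact Or.inl (tendsto_atTop_of_escape hL hN h0 h)
  · refine Or.inr (tendsto_neg_atTop_iff.1 (tendsto_atTop_of_escape (L := fun n => -L n) (B := B)
      (N := N) ?_ ?_ ?_ ?_))
    · intro n
      rw [neg_sub_neg, abs_sub_comm]
      exact hL n
    · simpa using hN
    · simpa using h0
    · simpa using h

variable {U : ℕ} {ρ : ℝ} {p : I} {ω : Environment U × (ℕ × Fin U → I)}

/-- With frozen signs the solo draws no longer depend on the individual urns, so the total evolves
autonomously. -/
theorem chain_forced_eq {s : Fin U → ℤˣ} {n₀ : ℕ}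
    (hs : ∀ n, n₀ ≤ n → ∀ u, ω.1 (n, u) ≠ 1 →
      pull ρ (chain (diffStep ρ) noise 0 n ω u) (ω.2 (n, u)) = s u) (j : ℕ) :
    chain (fun k y => k + forcedIncrement ρ s k y) (fun n => noise (n₀ + n))
        (∑ u, chain (diffStep ρ) noise 0 n₀ ω u) j ω
      = ∑ u, chain (diffStep ρ) noise 0 (n₀ + j) ω u := by
  induction j with
  | zero => rfl
  | succ j ih =>
    rw [chain_succ, ih, ← add_assoc]
    simp only [chain_succ, diffStep, forcedIncrement, noise]
    rw [Finset.sum_add_distrib]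
    congr 1
    refine Finset.sum_congr rfl fun u _ => ?_
    by_cases h : ω.1 (n₀ + j, u) = 1
    · simp only [h, if_true]
    · simp only [h, if_false]
      exact (hs _ (Nat.le_add_right _ _) u h).symm

theorem abs_sum_diff_le (n : ℕ) :
    |∑ u, chain (diffStep ρ) noise 0 (n + 1) ω u - ∑ u, chain (diffStep ρ) noise 0 n ω u| ≤ U := by
  rw [← Finset.sum_sub_distrib]
  refine (Finset.abs_sum_le_sum_abs _ _).trans ?_
  refine (Finset.sum_le_sum (g := fun _ => 1) fun u _ => ?_).trans (by simp)
  simp [chain, diffStep, abs_pull]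

/-- If from some time on the draws out of single urns have constant signs `s`, then the total
difference tends to infinity in a direction compatible with `s`, and the draws out of all the urns
combined eventually have the corresponding colour. -/
theorem ae_total_dichotomy (hU : 1 ≤ U) (hρ : 1 < ρ) (hp₀ : 0 < (p : ℝ)) (hp : (p : ℝ) < 1 / 2) :
    ∀ᵐ ω ∂annealedLaw U p, ∀ (s : Fin U → ℤˣ) (n₀ : ℕ),
      (∀ n, n₀ ≤ n → ∀ u, ω.1 (n, u) ≠ 1 →
        pull ρ (chain (diffStep ρ) noise 0 n ω u) (ω.2 (n, u)) = s u) →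
      (0 < (1 - p) * ∑ u, ((s u : ℤ) : ℝ) + p * U ∧ ∀ᶠ n in atTop, ∀ u,
        pull ρ (∑ v, chain (diffStep ρ) noise 0 n ω v) (ω.2 (n, u)) = 1) ∨
      ((1 - p) * ∑ u, ((s u : ℤ) : ℝ) - p * U < 0 ∧ ∀ᶠ n in atTop, ∀ u,
        pull ρ (∑ v, chain (diffStep ρ) noise 0 n ω v) (ω.2 (n, u)) = -1) := by
  -- Signs, freezing time and total at that time are random, but range over countable sets: one null
  -- set serves all deterministic choices.
  have key := ae_all_iff.2 fun s : Fin U → ℤˣ => ae_all_iff.2 fun n₀ : ℕ =>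
    ae_all_iff.2 fun m : ℤ =>
      ae_forced_escape (Y := fun n => noise (n₀ + n)) hU hρ hp₀ hp
        (iIndepFun_noise.precomp (g := fun n => n₀ + n) (add_right_injective n₀))
        (fun n => measurePreserving_noise (n₀ + n)) s m
  filter_upwards [key] with ω hω s n₀ hs
  obtain ⟨h1, h2, h3, h4⟩ := hω s n₀ (∑ u, chain (diffStep ρ) noise 0 n₀ ω u)
  simp only [chain_forced_eq hs] at h1 h2 h3 h4
  have h5 : ∀ᶠ n in atTop, ∀ u,
      ω.2 (n, u) ∉ minority ρ (∑ v, chain (diffStep ρ) noise 0 n ω v) := by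
    obtain ⟨N, hN⟩ := eventually_atTop.1 h2
    refine eventually_atTop.2 ⟨n₀ + N, fun n hn u => ?_⟩
    obtain ⟨j, rfl⟩ := Nat.exists_eq_add_of_le (show n₀ ≤ n by omega)
    exact hN j (by omega) u
  have hdich := tendsto_atTop_or_atBot_of_escape (B := U)
    (L := fun j => ∑ v, chain (diffStep ρ) noise 0 (n₀ + j) ω v)
    (fun j => by
      rw [← add_assoc]
      exact abs_sum_diff_le (n₀ + j)) h1
  have hshift : ∀ {l : Filter ℤ},
      Tendsto (fun j => ∑ v, chain (diffStep ρ) noise 0 (n₀ + j) ω v) atTop l →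
        Tendsto (fun n => ∑ v, chain (diffStep ρ) noise 0 n ω v) atTop l := by
    intro l h
    refine (tendsto_add_atTop_iff_nat n₀).1 ?_
    simp_rw [Nat.add_comm _ n₀]
    exact h
  rcases hdich with h | h
  · refine Or.inl ⟨not_le.1 fun hle => h3 hle h, ?_⟩
    filter_upwards [h5, (hshift h).eventually_ge_atTop 0] with n hn h0 u
    rw [pull_of_notMem_minority (hn u), if_pos h0]
  · refine Or.inr ⟨not_le.1 fun hle => h4 hle h, ?_⟩
    filter_upwards [h5, (hshift h).eventually_lt_atBot 0] with n hn h0 u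
    rw [pull_of_notMem_minority (hn u), if_neg (not_le.2 h0)]

theorem ae_exists_signs (hρ : 1 < ρ) (hp : (p : ℝ) < 1 / 2) :
    ∀ᵐ ω ∂annealedLaw U p, ∃ (s : Fin U → ℤˣ) (n₀ : ℕ), ∀ n, n₀ ≤ n → ∀ u,
      pull ρ (chain (diffStep ρ) noise 0 n ω u) (ω.2 (n, u)) = s u := by
  have key := ae_all_iff.2 fun u : Fin U =>
    ae_diff_escape (p := p) hρ hp iIndepFun_noise measurePreserving_noise 0 u
  filter_upwards [key] with ω hω
  have h : ∀ u, ∃ e : ℤˣ, ∀ᶠ n in atTop,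
      pull ρ (chain (diffStep ρ) noise 0 n ω u) (ω.2 (n, u)) = e := by
    intro u
    obtain ⟨h1, h2⟩ := hω u
    rcases tendsto_atTop_or_atBot_of_escape (B := 1)
      (L := fun n => chain (diffStep ρ) noise 0 n ω u)
      (fun n => by simp [chain, diffStep, abs_pull]) h1 with h | h
    · refine ⟨1, ?_⟩
      filter_upwards [h2, h.eventually_ge_atTop 0] with n hn h0
      exact (pull_of_notMem_minority hn).trans (if_pos h0)
    · refine ⟨-1, ?_⟩
      filter_upwards [h2, h.eventually_lt_atBot 0] with n hn h0
      exact (pull_of_notMem_minority hn).trans (if_neg (not_le.2 h0))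
  choose s hs using h
  obtain ⟨n₀, hn₀⟩ := eventually_atTop.1 (eventually_all.2 hs)
  exact ⟨s, n₀, hn₀⟩

theorem ae_isSuitable (hU : 1 ≤ U) (hρ : 1 < ρ) (hp₀ : 0 < (p : ℝ)) (hp : (p : ℝ) < 1 / 2) :
    ∀ᵐ ω ∂annealedLaw U p, IsSuitable ω.1
      ⟨process (fun i => ρ ^ i) ω.1 ω.2, isUrnPath_process _ ω.1 ω.2⟩ := by
  filter_upwards [ae_exists_signs hρ hp, ae_total_dichotomy hU hρ hp₀ hp] with ω h1 h2
  obtain ⟨s, n₀, hs⟩ := h1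
  obtain ⟨d, hd⟩ : ∃ d : Colour, ∀ᶠ n in atTop, ∀ u,
      pull ρ (∑ v, chain (diffStep ρ) noise 0 n ω v) (ω.2 (n, u)) = d.sign := by
    rcases h2 s n₀ fun n hn u _ => hs n hn u with h | h
    · exact ⟨.black, h.2⟩
    · exact ⟨.white, h.2⟩
  obtain ⟨n₁, hn₁⟩ := eventually_atTop.1 hd
  have hneg : ¬ ((-1 : ℤˣ) = 1) := by decide
  refine ⟨d, max n₀ n₁, fun u => ?_⟩
  by_cases hsd : (s u : ℤ) = d.sign
  · refine Or.inl fun n hn => ?_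
    rw [colour_eq_iff hρ]
    split_ifs
    · exact hn₁ n (le_of_max_le_right hn) u
    · exact (hs n (le_of_max_le_left hn) u).trans hsd
  · refine Or.inr fun n hn => ⟨fun hx => ?_, fun hx => ?_⟩
    · rw [colour_eq_iff hρ, if_pos hx]
      exact hn₁ n (le_of_max_le_right hn) u
    · rw [Ne, colour_eq_iff hρ, hx, if_neg hneg]
      rw [hs n (le_of_max_le_left hn) u]
      exact hsd

-- Any witness `(d, n₀)` of suitability prescribes signs for the solo draws, to which the dichotomy
-- applies; infinitely many combined draws force its direction to be that of `d`.
open Classical in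
theorem ae_satisfiesCE (hU : 1 ≤ U) (hρ : 1 < ρ) (hp₀ : 0 < (p : ℝ)) (hp : (p : ℝ) < 1 / 2) :
    ∀ᵐ ω ∂annealedLaw U p, SatisfiesCE p ω.1
      ⟨process (fun i => ρ ^ i) ω.1 ω.2, isUrnPath_process _ ω.1 ω.2⟩ := by
  have hfreq : ∀ᵐ ω ∂annealedLaw U p, ∃ᶠ n in atTop, ω.1 (n, (⟨0, hU⟩ : Fin U)) = 1 :=
    Measure.quasiMeasurePreserving_fst.ae (ae_frequently_combined hp₀ _)
  filter_upwards [hfreq, ae_total_dichotomy hU hρ hp₀ hp] with ω h1 h2 d n₀ hsuit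
  by_contra hN
  push Not at hN
  set r : UrnPath U := ⟨process (fun i => ρ ^ i) ω.1 ω.2, isUrnPath_process _ ω.1 ω.2⟩ with hr
  obtain ⟨e, he⟩ : ∃ e : ℤˣ, (e : ℤ) = d.sign := by
    cases d
    exacts [⟨1, rfl⟩, ⟨-1, rfl⟩]
  have hneg : ¬ ((-1 : ℤˣ) = 1) := by decide
  -- An urn that is both conformist and nonconformist makes no solo draw after `n₀`, so giving it
  -- the sign `-e` is harmless and matches the count of nonconformist urns.
  have hforced : ∀ n, n₀ ≤ n → ∀ u, ω.1 (n, u) ≠ 1 →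
      pull ρ (chain (diffStep ρ) noise 0 n ω u) (ω.2 (n, u))
        = ((if IsNonconformist ω.1 r d n₀ u then -e else e : ℤˣ) : ℤ) := by
    intro n hn u hx
    have hx' := (Int.units_eq_one_or (ω.1 (n, u))).resolve_left hx
    split_ifs with hnc
    · have := (hnc n hn).2 hx'
      rw [Ne, hr, colour_eq_iff hρ, if_neg hx] at this
      rw [Units.val_neg, he]
      rcases pull_eq_or ρ (chain (diffStep ρ) noise 0 n ω u) (ω.2 (n, u)) with h | h <;>
      · rw [h] at this ⊢
        cases d <;> simp_all [Colour.sign]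
    · have := ((hsuit u).resolve_right hnc) n hn
      rw [hr, colour_eq_iff hρ, if_neg hx] at this
      rw [he]
      exact this
  have hsum : ∑ u, (((if IsNonconformist ω.1 r d n₀ u then -e else e : ℤˣ) : ℤ) : ℝ)
      = ((e : ℤ) : ℝ) * (U - 2 * numNonconformist ω.1 r d n₀) := by
    have hcard : (numNonconformist ω.1 r d n₀ : ℝ)
        = ∑ u, if IsNonconformist ω.1 r d n₀ u then (1 : ℝ) else 0 := by
      rw [numNonconformist, Set.ncard_eq_toFinset_card', Finset.sum_boole]
      congr 2
      ext u
      simp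
    have hUsum : (U : ℝ) = ∑ _u : Fin U, (1 : ℝ) := by simp
    rw [hcard, hUsum, Finset.mul_sum, ← Finset.sum_sub_distrib, Finset.mul_sum]
    refine Finset.sum_congr rfl fun u _ => ?_
    split_ifs
    · push_cast; ring
    · ring
  have hcomb : ∃ᶠ n in atTop,
      pull ρ (∑ v, chain (diffStep ρ) noise 0 n ω v) (ω.2 (n, ⟨0, hU⟩)) = d.sign := by
    refine (h1.and_eventually (eventually_ge_atTop n₀)).mono fun n hn => ?_
    have hc : colour r n ⟨0, hU⟩ = d := by
      rcases hsuit ⟨0, hU⟩ with h | h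
      · exact h n hn.2
      · exact (h n hn.2).1 hn.1
    rwa [hr, colour_eq_iff hρ, if_pos hn.1] at hc
  have h3 := h2 _ n₀ hforced
  rw [hsum, he] at h3
  -- In the direction of `d` the drift condition reads `0 < (1 - p) * (U - 2 * N) + p * U = U - 2 *
  -- (1 - p) * N`, against `hN`; the other direction contradicts `hcomb`.
  rcases h3 with ⟨h3, h4⟩ | ⟨h3, h4⟩
  · obtain ⟨n, hn1, hn2⟩ := (hcomb.and_eventually h4).exists
    rw [hn2] at hn1
    cases d
    · simp only [Colour.sign, Int.cast_one] at h3
      nlinarith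
    · simp [Colour.sign] at hn1
  · obtain ⟨n, hn1, hn2⟩ := (hcomb.and_eventually h4).exists
    rw [hn2] at hn1
    cases d
    · simp [Colour.sign] at hn1
    · simp only [Colour.sign, Int.cast_neg, Int.cast_one] at h3
      nlinarith

end Paths

end InteractingUrns

theorem theorem3p10 (U : ℕ) (hU : 1 ≤ U) (ρ : ℝ) (hρ : 1 < ρ)
    (p : unitInterval) (hp₀ : 0 < (p : ℝ)) (hp : (p : ℝ) < 1 / 2) :
    ∀ᵐ x ∂InteractingUrns.environmentLaw U p,
      InteractingUrns.IUM (fun i => ρ ^ i) x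
        {r | InteractingUrns.IsSuitable x r ∧ InteractingUrns.SatisfiesCE p x r} = 1 := by
  have h := (InteractingUrns.ae_isSuitable hU hρ hp₀ hp).and
    (InteractingUrns.ae_satisfiesCE hU hρ hp₀ hp)
  filter_upwards [Measure.ae_ae_of_ae_prod h] with x hx
  exact InteractingUrns.IUM_eq_one_of_ae hx
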